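/- All matrices are semi-infinite, indexed by $m,n\in\mathbb N_0$, with complex entries; for a tridiagonal $J$ the products $HJ$ and $JH$ are defined entrywise by finite sums. A matrix $H$ is Hankel if $H_{m,n}=h_{m+n}$ for some sequence $(h_k)$; its rank is the dimension of the span of its columns. For real $t>0$ let $\mathcal H_t$ be the generalized Hilbert matrix with entries $\frac1{m+n+t}$, let $\tilde{\mathcal H}_t$ be the Hankel matrix with entries $\frac{(-1)^{m+n}}{m+n+t}$, and let $U=\mathrm{diag}(1,-1,1,-1,\dots)$. By a (Hermitian non-decomposable) Jacobi matrix from the Askey scheme we mean a matrix $J$ with $J_{n,n}=\beta_n$, $J_{n,n+1}=J_{n+1,n}=\alpha_n$ and $J_{m,n}=0$ for $|m-n|>1$, where $(\alpha_n),(\beta_n)$ are one of the following. (If a factor of a numerator and a factor of a denominator vanish together at $n=0$ they are cancelled, and $C_0=0$.) 1. Wilson: $\alpha_n=\sqrt{A_nC_{n+1}}$, $\beta_n=A_n+C_n-a^2$ with $s=a+b+c+d$, $A_n=\frac{(n+a+b)(n+a+c)(n+a+d)(n+s-1)}{(2n+s-1)(2n+s)}$, $C_n=\frac{n(n+b+c-1)(n+b+d-1)(n+c+d-1)}{(2n+s-2)(2n+s-1)}$;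 non-real parameters among $a,b,c,d\in\mathbb C$ occur in complex conjugate pairs, and either all four have positive real part or, up to a permutation, $a$ is real, $a\le 0$, and $a+b,a+c,a+d$ have positive real parts. 2. Continuous dual Hahn: $\alpha_n=\sqrt{A_nC_{n+1}}$, $\beta_n=A_n+C_n-a^2$ with $A_n=(n+a+b)(n+a+c)$, $C_n=n(n+b+c-1)$; non-real parameters among $a,b,c\in\mathbb C$ occur in complex conjugate pairs, and either all three have positive real part or, up to a permutation, $a$ is real, $a\le0$, and $a+b,a+c$ have positive real parts. 3. Continuous Hahn: $\alpha_n=\sqrt{-A_nC_{n+1}}$, $\beta_n=\mathrm i(A_n+C_n+a)$ with $s=a+b+c+d$, $A_n=-\frac{(n+s-1)(n+a+c)(n+a+d)}{(2n+s-1)(2n+s)}$, $C_n=\frac{n(n+b+c-1)(n+b+d-1)}{(2n+s-2)(2n+s-1)}$; $c=\bar a$, $d=\bar b$, $\Re a>0$, $\Re b>0$. 4. Jacobi ($\alpha,\beta>-1$): $\alpha_n=\sqrt{\frac{4(n+1)(n+\alpha+1)(n+\beta+1)(n+\alpha+\beta+1)}{(2n+\alpha+\beta+1)(2n+\alpha+\beta+2)^2(2n+\alpha+\beta+3)}}$,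 $\beta_n=\frac{\beta^2-\alpha^2}{(2n+\alpha+\beta)(2n+\alpha+\beta+2)}$. 5. Meixner–Pollaczek ($\lambda>0$, $0<\phi<\pi$): $\alpha_n=\frac{\sqrt{(n+1)(n+2\lambda)}}{2\sin\phi}$, $\beta_n=-(n+\lambda)\cot\phi$. 6. Meixner ($\beta>0$, $0<c<1$): $\alpha_n=\frac{\sqrt{c(n+1)(n+\beta)}}{1-c}$, $\beta_n=\frac{n+(n+\beta)c}{1-c}$. 7. Laguerre ($\alpha>-1$): $\alpha_n=\sqrt{(n+1)(n+\alpha+1)}$, $\beta_n=2n+\alpha+1$. 8. Charlier ($a>0$): $\alpha_n=\sqrt{a(n+1)}$, $\beta_n=n+a$. 9. Hermite: $\alpha_n=\sqrt{(n+1)/2}$, $\beta_n=0$. **Theorem.** (i) Let $H$ be a Hankel matrix with square-summable columns and $\operatorname{rank}H>1$, and let $J$ be any Hermitian non-decomposable Jacobi matrix from the Askey scheme. If $HJ=JH$, then $H=\kappa\,\tilde{\mathcal H}_t$ for some $t>0$ and some scalar $\kappa$. (ii) Hence the generalized Hilbert matrix is the only infinite-rank Hankel matrix to which the commutator method with these Jacobi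 matrices applies: a matrix $H$ is a Hankel matrix of infinite rank with square-summable columns that commutes with some Jacobi matrix from the Askey scheme if and only if $UHU=\kappa\,\mathcal H_t$ for some $t>0$ and some scalar $\kappa\neq0$. -/

import Mathlib

noncomputable section

namespace AskeyHankel

/-! ### Semi-infinite matrices, indexed by `ℕ`, with complex entries -/

/-- The entrywise product `(A B)_{m,n} = ∑_k A_{m,k} B_{k,n}`. It is used only when one of the
factors is tridiagonal, and then only finitely many terms of each sum are nonzero. -/
def mul (A B : Matrix ℕ ℕ ℂ) : Matrix ℕ ℕ ℂ :=
  Matrix.of fun m n => ∑ᶠ k, A m k * B k n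

/-- A Hankel matrix: the entry at `(m, n)` depends only on `m + n`. -/
def IsHankel (H : Matrix ℕ ℕ ℂ) : Prop :=
  ∃ h : ℕ → ℂ, ∀ m n, H m n = h (m + n)

/-- All columns are square summable. -/
def HasL2Columns (H : Matrix ℕ ℕ ℂ) : Prop :=
  ∀ n, Summable fun m => ‖H m n‖ ^ 2

/-- The Jacobi matrix with diagonal `β` and off-diagonal `α`. -/
def jacobiMatrix (α β : ℕ → ℝ) : Matrix ℕ ℕ ℂ :=
  Matrix.of fun m n =>
    if m = n then (β n : ℂ)
    else if m = n + 1 then (α n : ℂ)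
    else if n = m + 1 then (α m : ℂ)
    else 0

/-- The generalized Hilbert matrix, with entries `1 / (m + n + t)`. -/
def hilbertMatrix (t : ℝ) : Matrix ℕ ℕ ℂ :=
  Matrix.of fun m n => 1 / ((m : ℂ) + n + t)

/-- The transformed Hilbert matrix, with entries `(-1) ^ (m + n) / (m + n + t)`. -/
def transformedHilbert (t : ℝ) : Matrix ℕ ℕ ℂ :=
  Matrix.of fun m n => (-1) ^ (m + n) / ((m : ℂ) + n + t)

/-- `U H U` for the unitary diagonal matrix `U = diag (1, -1, 1, -1, …)`. -/
def signConj (H : Matrix ℕ ℕ ℂ) : Matrix ℕ ℕ ℂ :=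
  Matrix.of fun m n => (-1) ^ m * H m n * (-1) ^ n

/-! ### The nine families

Where a factor of a numerator and of a denominator vanish together at `n = 0`, the value at `n = 0`
is the one obtained after cancelling the common factor, and `C₀ = 0`. -/

/-- The non-real members of the multiset occur in complex conjugate pairs. -/
def ConjPaired (s : Multiset ℂ) : Prop := s.map star = s

/-! #### Wilson -/

def wilsonA (a b c d : ℂ) : ℕ → ℂ
  | 0 => (a + b) * (a + c) * (a + d) / (a + b + c + d)
  | n@(_ + 1) =>
    (n + a + b) * (n + a + c) * (n + a + d) * (n + a + b + c + d - 1) /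
      ((2 * n + a + b + c + d - 1) * (2 * n + a + b + c + d))

def wilsonC (a b c d : ℂ) : ℕ → ℂ
  | 0 => 0
  | n@(_ + 1) =>
    n * (n + b + c - 1) * (n + b + d - 1) * (n + c + d - 1) /
      ((2 * n + a + b + c + d - 2) * (2 * n + a + b + c + d - 1))

/-- For admissible parameters the number under the real part is real and positive. -/
def wilsonα (a b c d : ℂ) (n : ℕ) : ℝ :=
  √(wilsonA a b c d n * wilsonC a b c d (n + 1)).re

/-- For admissible parameters the number under the real part is real. -/
def wilsonβ (a b c d : ℂ) (n : ℕ) : ℝ :=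
  (wilsonA a b c d n + wilsonC a b c d n - a ^ 2).re

/-- Non-real parameters come in conjugate pairs, and either all real parts are positive, or, up to
a permutation, `a` is real and nonpositive and `a + b`, `a + c`, `a + d` have positive real parts
(they are then positive, or one is positive and the other two are conjugate). -/
def WilsonAdmissible (a b c d : ℂ) : Prop :=
  ConjPaired {a, b, c, d} ∧
    ((0 < a.re ∧ 0 < b.re ∧ 0 < c.re ∧ 0 < d.re) ∨
      ∃ a' b' c' d' : ℂ, ({a', b', c', d'} : Multiset ℂ) = {a, b, c, d} ∧
        a'.im = 0 ∧ a'.re ≤ 0 ∧ 0 < (a' + b').re ∧ 0 < (a' + c').re ∧ 0 < (a' + d').re)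

/-! #### Continuous dual Hahn -/

def contDualHahnA (a b c : ℂ) (n : ℕ) : ℂ := (n + a + b) * (n + a + c)

def contDualHahnC (_a b c : ℂ) (n : ℕ) : ℂ := n * (n + b + c - 1)

/-- For admissible parameters the number under the real part is real and positive. -/
def contDualHahnα (a b c : ℂ) (n : ℕ) : ℝ :=
  √(contDualHahnA a b c n * contDualHahnC a b c (n + 1)).re

/-- For admissible parameters the number under the real part is real. -/
def contDualHahnβ (a b c : ℂ) (n : ℕ) : ℝ :=
  (contDualHahnA a b c n + contDualHahnC a b c n - a ^ 2).re

def ContDualHahnAdmissible (a b c : ℂ) : Prop :=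
  ConjPaired {a, b, c} ∧
    ((0 < a.re ∧ 0 < b.re ∧ 0 < c.re) ∨
      ∃ a' b' c' : ℂ, ({a', b', c'} : Multiset ℂ) = {a, b, c} ∧
        a'.im = 0 ∧ a'.re ≤ 0 ∧ 0 < (a' + b').re ∧ 0 < (a' + c').re)

/-! #### Continuous Hahn -/

def contHahnA (a b c d : ℂ) : ℕ → ℂ
  | 0 => -((a + c) * (a + d) / (a + b + c + d))
  | n@(_ + 1) =>
    -((n + a + b + c + d - 1) * (n + a + c) * (n + a + d) /
      ((2 * n + a + b + c + d - 1) * (2 * n + a + b + c + d)))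

def contHahnC (a b c d : ℂ) : ℕ → ℂ
  | 0 => 0
  | n@(_ + 1) =>
    n * (n + b + c - 1) * (n + b + d - 1) /
      ((2 * n + a + b + c + d - 2) * (2 * n + a + b + c + d - 1))

/-- For admissible parameters the number under the real part is real and positive. -/
def contHahnα (a b c d : ℂ) (n : ℕ) : ℝ :=
  √(-(contHahnA a b c d n * contHahnC a b c d (n + 1))).re

/-- For admissible parameters the number under the real part is real. -/
def contHahnβ (a b c d : ℂ) (n : ℕ) : ℝ :=
  (Complex.I * (contHahnA a b c d n + contHahnC a b c d n + a)).re

def ContHahnAdmissible (a b c d : ℂ) : Prop :=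
  c = star a ∧ d = star b ∧ 0 < a.re ∧ 0 < b.re

/-! #### Jacobi -/

def jacobiα (p q : ℝ) : ℕ → ℝ
  | 0 => √(4 * (p + 1) * (q + 1) / ((p + q + 2) ^ 2 * (p + q + 3)))
  | n@(_ + 1) =>
    √(4 * (n + 1) * (n + p + 1) * (n + q + 1) * (n + p + q + 1) /
      ((2 * n + p + q + 1) * (2 * n + p + q + 2) ^ 2 * (2 * n + p + q + 3)))

def jacobiβ (p q : ℝ) : ℕ → ℝ
  | 0 => (q - p) / (p + q + 2)
  | n@(_ + 1) => (q ^ 2 - p ^ 2) / ((2 * n + p + q) * (2 * n + p + q + 2))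

/-! #### Meixner–Pollaczek, Meixner, Laguerre, Charlier, Hermite -/

def meixnerPollaczekα (l φ : ℝ) (n : ℕ) : ℝ := √((n + 1) * (n + 2 * l)) / (2 * Real.sin φ)

def meixnerPollaczekβ (l φ : ℝ) (n : ℕ) : ℝ := -((n + l) * Real.cos φ / Real.sin φ)

def meixnerα (c b : ℝ) (n : ℕ) : ℝ := √(c * (n + 1) * (n + b)) / (1 - c)

def meixnerβ (c b : ℝ) (n : ℕ) : ℝ := (n + (n + b) * c) / (1 - c)

def laguerreα (p : ℝ) (n : ℕ) : ℝ := √((n + 1) * (n + p + 1))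

def laguerreβ (p : ℝ) (n : ℕ) : ℝ := 2 * n + p + 1

def charlierα (a : ℝ) (n : ℕ) : ℝ := √(a * (n + 1))

def charlierβ (a : ℝ) (n : ℕ) : ℝ := n + a

def hermiteα (n : ℕ) : ℝ := √((n + 1) / 2)

def hermiteβ (_n : ℕ) : ℝ := 0

/-- The Hermitian non-decomposable Jacobi matrices from the Askey scheme. -/
inductive IsAskeyJacobi : Matrix ℕ ℕ ℂ → Prop
  | wilson (a b c d : ℂ) (h : WilsonAdmissible a b c d) :
      IsAskeyJacobi (jacobiMatrix (wilsonα a b c d) (wilsonβ a b c d))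
  | contDualHahn (a b c : ℂ) (h : ContDualHahnAdmissible a b c) :
      IsAskeyJacobi (jacobiMatrix (contDualHahnα a b c) (contDualHahnβ a b c))
  | contHahn (a b c d : ℂ) (h : ContHahnAdmissible a b c d) :
      IsAskeyJacobi (jacobiMatrix (contHahnα a b c d) (contHahnβ a b c d))
  | jacobi (p q : ℝ) (hp : -1 < p) (hq : -1 < q) :
      IsAskeyJacobi (jacobiMatrix (jacobiα p q) (jacobiβ p q))
  | meixnerPollaczek (l φ : ℝ) (hl : 0 < l) (h0 : 0 < φ) (hπ : φ < Real.pi) :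
      IsAskeyJacobi (jacobiMatrix (meixnerPollaczekα l φ) (meixnerPollaczekβ l φ))
  | meixner (c b : ℝ) (h0 : 0 < c) (h1 : c < 1) (hb : 0 < b) :
      IsAskeyJacobi (jacobiMatrix (meixnerα c b) (meixnerβ c b))
  | laguerre (p : ℝ) (hp : -1 < p) :
      IsAskeyJacobi (jacobiMatrix (laguerreα p) (laguerreβ p))
  | charlier (a : ℝ) (ha : 0 < a) :
      IsAskeyJacobi (jacobiMatrix (charlierα a) (charlierβ a))
  | hermite : IsAskeyJacobi (jacobiMatrix hermiteα hermiteβ)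

end AskeyHankel

end

/-!
Write `h` for the sequence of the Hankel matrix. Off the first row and column, `HJ = JH` says that
`h N * α m + h (N + 1) * β (m + 1) + h (N + 2) * α (m + 1)` is invariant under `m ↦ N - 1 - m`.
Rescale `(h N, h (N + 1), h (N + 2))` to unit vectors and pass to a limit `(x, y, z)` along a
subsequence. The reflected indices tend to infinity, where the second differences of `α` and `β`
converge, so `x * α m + y * β (m + 1) + z * α (m + 1)` has constant second differences in `m` and is
a polynomial in `m`. Since `α ^ 2` and `β` are rational functions of the index, `α ^ 2` must then be
the square of a rational function. Hence the linear factors of `α ^ 2` pair up, which fixes the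
parameters of each family to the point where `HJ = JH` becomes a recurrence with explicit solutions.
The decaying ones are zero, geometric, or multiples of `(-1) ^ k / (k + t)`.
-/

noncomputable section

namespace AskeyHankel

open Filter Topology Polynomial Asymptotics

/-- The Hankel matrix with entries `h (m + n)`. -/
def hankelMatrix (h : ℕ → ℂ) : Matrix ℕ ℕ ℂ := Matrix.of fun m n => h (m + n)

lemma hankelMatrix_apply (h : ℕ → ℂ) (m n : ℕ) : hankelMatrix h m n = h (m + n) := rfl

lemma IsHankel.exists_eq_hankelMatrix {H : Matrix ℕ ℕ ℂ} (hH : IsHankel H) :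
    ∃ h, H = hankelMatrix h :=
  hH.imp fun _ hh => Matrix.ext hh

/-- An entry in column `m + 1` of the product of a matrix `H` and the Jacobi matrix of `α` and `β`,
as a function of the entries `u` of `H` in the columns `m`, `m + 1`, `m + 2` of the same row. -/
def rowForm (α β : ℕ → ℝ) (u : ℂ × ℂ × ℂ) (m : ℕ) : ℂ :=
  u.1 * α m + u.2.1 * β (m + 1) + u.2.2 * α (m + 1)

/-- Three consecutive terms of a sequence. -/
def window (h : ℕ → ℂ) (N : ℕ) : ℂ × ℂ × ℂ := (h N, h (N + 1), h (N + 2))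

/-- `rowForm α β (v N)` is invariant under `m ↦ N - 1 - m`. -/
def HasSymmetricRows (α β : ℕ → ℝ) (v : ℕ → ℂ × ℂ × ℂ) : Prop :=
  ∀ m n, rowForm α β (v (m + n + 1)) n = rowForm α β (v (m + n + 1)) m

/-- The equations `HJ = JH`, entry by entry, for the Hankel matrix `H` of `h` and the Jacobi
matrix `J` of `α` and `β`; the entries of the first row have a separate form. -/
structure HankelRows (α β : ℕ → ℝ) (h : ℕ → ℂ) : Prop where
  row_zero : ∀ n, rowForm α β (window h n) n = β 0 * h (n + 1) + α 0 * h (n + 2)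
  row_succ : HasSymmetricRows α β (window h)

section Commutation

variable (α β : ℕ → ℝ)

lemma mul_jacobiMatrix_zero (H : Matrix ℕ ℕ ℂ) (m : ℕ) :
    mul H (jacobiMatrix α β) m 0 = H m 0 * β 0 + H m 1 * α 0 := by
  rw [mul, Matrix.of_apply, finsum_eq_sum_of_support_subset (s := {0, 1})]
  · simp [jacobiMatrix]
  · intro k hk
    contrapose! hk
    simp only [Finset.coe_insert, Finset.coe_singleton, Set.mem_insert_iff,
      Set.mem_singleton_iff, not_or] at hk
    simp [jacobiMatrix, hk]

lemma mul_jacobiMatrix_succ (H : Matrix ℕ ℕ ℂ) (m n : ℕ) :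
    mul H (jacobiMatrix α β) m (n + 1) = rowForm α β (H m n, H m (n + 1), H m (n + 2)) n := by
  rw [mul, Matrix.of_apply, finsum_eq_sum_of_support_subset (s := {n, n + 1, n + 2})]
  · simp [jacobiMatrix, rowForm, add_assoc]
  · intro k hk
    contrapose! hk
    simp only [Finset.coe_insert, Finset.coe_singleton, Set.mem_insert_iff,
      Set.mem_singleton_iff, not_or] at hk
    simp [jacobiMatrix, hk.2.1, hk.2.2, Ne.symm hk.1]

lemma jacobiMatrix_comm (m n : ℕ) : jacobiMatrix α β m n = jacobiMatrix α β n m := by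
  simp only [jacobiMatrix, Matrix.of_apply]
  split_ifs <;> first | omega | simp_all

lemma jacobiMatrix_mul_hankelMatrix (h : ℕ → ℂ) (m n : ℕ) :
    mul (jacobiMatrix α β) (hankelMatrix h) m n = mul (hankelMatrix h) (jacobiMatrix α β) n m := by
  refine finsum_congr fun k => ?_
  rw [jacobiMatrix_comm, hankelMatrix_apply, hankelMatrix_apply, add_comm k n, mul_comm]

lemma hankelMatrix_mul_jacobiMatrix_zero (h : ℕ → ℂ) (m : ℕ) :
    mul (hankelMatrix h) (jacobiMatrix α β) m 0 = β 0 * h m + α 0 * h (m + 1) := by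
  rw [mul_jacobiMatrix_zero, hankelMatrix_apply, hankelMatrix_apply, add_zero]
  ring

lemma hankelMatrix_mul_jacobiMatrix_succ (h : ℕ → ℂ) (m n : ℕ) :
    mul (hankelMatrix h) (jacobiMatrix α β) m (n + 1) = rowForm α β (window h (m + n)) n :=
  mul_jacobiMatrix_succ α β _ m n

theorem mul_comm_iff_hankelRows (h : ℕ → ℂ) :
    mul (hankelMatrix h) (jacobiMatrix α β) = mul (jacobiMatrix α β) (hankelMatrix h) ↔
      HankelRows α β h := by
  simp only [← Matrix.ext_iff, jacobiMatrix_mul_hankelMatrix]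
  constructor
  · refine fun hc => ⟨fun n => ?_, fun m n => ?_⟩
    · simpa only [hankelMatrix_mul_jacobiMatrix_zero, hankelMatrix_mul_jacobiMatrix_succ, zero_add]
        using hc 0 (n + 1)
    · simpa only [hankelMatrix_mul_jacobiMatrix_succ, add_right_comm _ 1, add_comm n m]
        using hc (m + 1) (n + 1)
  · rintro ⟨row_zero, row_succ⟩ (_ | m) (_ | n)
    · rfl
    · simpa only [hankelMatrix_mul_jacobiMatrix_zero, hankelMatrix_mul_jacobiMatrix_succ, zero_add]
        using row_zero n
    · simpa only [hankelMatrix_mul_jacobiMatrix_zero, hankelMatrix_mul_jacobiMatrix_succ, zero_add]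
        using (row_zero m).symm
    · simpa only [hankelMatrix_mul_jacobiMatrix_succ, add_right_comm _ 1, add_comm n m]
        using row_succ m n

end Commutation

lemma HasL2Columns.tendsto_zero {h : ℕ → ℂ} (hL : HasL2Columns (hankelMatrix h)) :
    Tendsto h atTop (𝓝 0) := by
  have hsq : Tendsto (fun m => ‖h m‖ ^ 2) atTop (𝓝 0) := (hL 0).tendsto_atTop_zero
  rw [tendsto_zero_iff_norm_tendsto_zero]
  simpa using hsq.sqrt

/-- Geometric sequences; the Hankel matrix of such a sequence has rank at most one. The zero
sequence is included. -/
def IsGeometric {R : Type*} [Mul R] (h : ℕ → R) : Prop := ∃ r, ∀ k, h (k + 1) = r * h k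

lemma IsGeometric.zero {R : Type*} [MulZeroClass R] : IsGeometric (0 : ℕ → R) :=
  ⟨0, fun _ => (zero_mul _).symm⟩

lemma IsGeometric.eRank_hankelMatrix_le_one {h : ℕ → ℂ} (hh : IsGeometric h) :
    (hankelMatrix h).eRank ≤ 1 := by
  obtain ⟨r, hr⟩ := hh
  have hpow : ∀ n m, h (m + n) = r ^ n * h m := by
    intro n m
    induction n with
    | zero => simp
    | succ n ih => rw [← add_assoc, hr, ih, pow_succ', mul_assoc]
  have hsub : Submodule.span ℂ (Set.range (hankelMatrix h).col) ≤ Submodule.span ℂ {h} := by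
    rw [Submodule.span_le]
    rintro _ ⟨n, rfl⟩
    exact Submodule.mem_span_singleton.2 ⟨r ^ n, funext fun m => (hpow n m).symm⟩
  have hcRank : (hankelMatrix h).cRank ≤ 1 :=
    (Submodule.rank_mono hsub).trans ((rank_span_le _).trans (by simp))
  simpa [Matrix.eRank] using OrderHom.mono (β := ℕ∞) Cardinal.toENat hcRank

section Recurrence

variable {R : Type*} [CommRing R] {h : ℕ → R} {b : R}

lemma casoratian_eq_of_recurrence (hb : ∀ k, h k + b * h (k + 1) + h (k + 2) = 0) (k : ℕ) :
    h k * h (k + 2) - h (k + 1) ^ 2 = h 0 * h 2 - h 1 ^ 2 := by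
  induction k with
  | zero => rfl
  | succ k ih => linear_combination ih + h (k + 1) * hb (k + 1) - h (k + 2) * hb k

lemma mul_eq_mul_of_casoratian_eq_zero [IsDomain R]
    (hb : ∀ k, h k + b * h (k + 1) + h (k + 2) = 0) (hd : h 0 * h 2 = h 1 ^ 2) (k : ℕ) :
    h 0 * h (k + 1) = h 1 * h k := by
  induction k using Nat.twoStepInduction with
  | zero => rw [mul_comm]
  | one => rw [hd, sq]
  | more k ih₀ ih₁ => linear_combination h 0 * hb (k + 1) - h 1 * hb k - ih₀ - b * ih₁

end Recurrence

/-- The roots of the recurrence have product one, so a decaying solution involves only one. -/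
lemma isGeometric_of_recurrence {𝕜 : Type*} [NormedField 𝕜] {h : ℕ → 𝕜}
    (hlim : Tendsto h atTop (𝓝 0)) {b : 𝕜} (hb : ∀ k, h k + b * h (k + 1) + h (k + 2) = 0) :
    IsGeometric h := by
  have hdet : h 0 * h 2 = h 1 ^ 2 := by
    have hcas : Tendsto (fun k => h k * h (k + 2) - h (k + 1) ^ 2) atTop (𝓝 0) := by
      have h₁ := (tendsto_add_atTop_iff_nat 1).2 hlim
      have h₂ := (tendsto_add_atTop_iff_nat 2).2 hlim
      simpa using (hlim.mul h₂).sub (h₁.pow 2)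
    simp only [casoratian_eq_of_recurrence hb] at hcas
    exact sub_eq_zero.1 (tendsto_nhds_unique tendsto_const_nhds hcas)
  by_cases h0 : h 0 = 0
  · have h1 : h 1 = 0 := by simpa [h0] using hdet.symm
    have hz : ∀ k, h k = 0 := by
      intro k
      induction k using Nat.twoStepInduction with
      | zero => exact h0
      | one => exact h1
      | more k ih₀ ih₁ => simpa [ih₀, ih₁] using hb k
    exact ⟨0, fun k => by rw [hz, hz, mul_zero]⟩
  · refine ⟨h 1 / h 0, fun k => ?_⟩
    rw [div_mul_eq_mul_div, eq_div_iff h0, mul_comm, mul_eq_mul_of_casoratian_eq_zero hb hdet]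

namespace HankelRows

variable {α β : ℕ → ℝ} {h : ℕ → ℂ}

lemma eq_zero_of_two_zeros (hr : HankelRows α β h) (hα : ∀ n, α n ≠ 0) {N : ℕ}
    (h₀ : h N = 0) (h₁ : h (N + 1) = 0) : ∀ k ≤ N, h k = 0 := by
  induction N with
  | zero =>
    rintro k hk
    rwa [Nat.le_zero.1 hk]
  | succ N ih =>
    have hN : h N = 0 := by simpa [rowForm, window, h₀, h₁, hα N] using hr.row_zero N
    rintro k hk
    rcases hk.lt_or_eq with hlt | rfl
    · exact ih hN h₀ k (Nat.le_of_lt_succ hlt)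
    · exact h₀

lemma eq_zero_of_eventually (hr : HankelRows α β h) (hα : ∀ n, α n ≠ 0)
    (hh : ∀ᶠ k in atTop, h k = 0) : h = 0 := by
  obtain ⟨N, hN⟩ := eventually_atTop.1 hh
  funext k
  exact hr.eq_zero_of_two_zeros hα (hN (N + k) (by omega)) (hN (N + k + 1) (by omega)) k (by omega)

lemma frequently_window_ne_zero (hr : HankelRows α β h) (hα : ∀ n, α n ≠ 0) (hh : h ≠ 0) :
    ∃ᶠ N in atTop, window h N ≠ 0 := fun hev =>
  hh <| hr.eq_zero_of_eventually hα <| hev.mono fun _ hN => congrArg Prod.fst (not_not.1 hN)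

end HankelRows

section FwdDiff

variable {R : Type*} [CommRing R] (f : ℕ → R)

lemma fwdDiff_iter_two_apply (n : ℕ) : (fwdDiff 1)^[2] f n = f (n + 2) - 2 * f (n + 1) + f n := by
  simp only [Function.iterate_succ_apply, Function.iterate_zero, id, fwdDiff, add_assoc]
  ring

lemma eq_of_fwdDiff_iter_two_eq {f g : ℕ → R} (hfg : ∀ n, (fwdDiff 1)^[2] f n = (fwdDiff 1)^[2] g n)
    (h₀ : f 0 = g 0) (h₁ : f 1 = g 1) (n : ℕ) : f n = g n := by
  simp only [fwdDiff_iter_two_apply] at hfg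
  induction n using Nat.twoStepInduction with
  | zero => exact h₀
  | one => exact h₁
  | more n ih₀ ih₁ => linear_combination hfg n + 2 * ih₁ - ih₀

lemma exists_eval_eq_of_fwdDiff_iter_two_eq_const [Invertible (2 : R)] {f : ℕ → R} {E : R}
    (hf : ∀ n, (fwdDiff 1)^[2] f n = E) : ∃ q : R[X], ∀ n : ℕ, f n = q.eval (n : R) := by
  refine ⟨C (f 0) + C (f 1 - f 0) * X + C (⅟2 * E) * X * (X - 1),
    eq_of_fwdDiff_iter_two_eq (fun n => ?_) (by simp) (by simp)⟩
  rw [hf, fwdDiff_iter_two_apply]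
  simp only [eval_add, eval_C, eval_mul, eval_X, eval_sub, eval_one, Nat.cast_add, Nat.cast_ofNat,
    Nat.cast_one]
  linear_combination -E * mul_invOf_self (2 : R)

end FwdDiff

section LimitDirection

variable {α β : ℕ → ℝ} {v : ℕ → ℂ × ℂ × ℂ} {u : ℂ × ℂ × ℂ}

lemma rowForm_smul (c : ℂ) (u : ℂ × ℂ × ℂ) (m : ℕ) :
    rowForm α β (c • u) m = c * rowForm α β u m := by
  simp only [rowForm, Prod.smul_fst, Prod.smul_snd, smul_eq_mul]
  ring

lemma fwdDiff_iter_two_rowForm (u : ℂ × ℂ × ℂ) :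
    (fwdDiff 1)^[2] (rowForm α β u) = rowForm ((fwdDiff 1)^[2] α) ((fwdDiff 1)^[2] β) u := by
  funext m
  simp only [fwdDiff_iter_two_apply, rowForm, Complex.ofReal_add, Complex.ofReal_sub,
    Complex.ofReal_mul, Complex.ofReal_ofNat]
  ring_nf

lemma HasSymmetricRows.smul (hs : HasSymmetricRows α β v) (c : ℕ → ℂ) :
    HasSymmetricRows α β fun N => c N • v N := fun m n => by
  rw [rowForm_smul, rowForm_smul, hs]

lemma HasSymmetricRows.fwdDiff_iter_two (hs : HasSymmetricRows α β v) (m n : ℕ) :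
    rowForm ((fwdDiff 1)^[2] α) ((fwdDiff 1)^[2] β) (v (m + n + 3)) n =
      rowForm ((fwdDiff 1)^[2] α) ((fwdDiff 1)^[2] β) (v (m + n + 3)) m := by
  have h₀ := hs m (n + 2)
  have h₁ := hs (m + 1) (n + 1)
  have h₂ := hs (m + 2) n
  rw [show m + (n + 2) + 1 = m + n + 3 by ring] at h₀
  rw [show m + 1 + (n + 1) + 1 = m + n + 3 by ring] at h₁
  rw [show m + 2 + n + 1 = m + n + 3 by ring] at h₂
  rw [← fwdDiff_iter_two_rowForm, fwdDiff_iter_two_apply, fwdDiff_iter_two_apply]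
  linear_combination h₀ - 2 * h₁ + h₂

lemma tendsto_rowForm {l : Filter ℕ} {w : ℕ → ℂ × ℂ × ℂ} (hw : Tendsto w l (𝓝 u)) {ν : ℕ → ℕ}
    {A B A' : ℝ} (hα : Tendsto (fun k => α (ν k)) l (𝓝 A))
    (hβ : Tendsto (fun k => β (ν k + 1)) l (𝓝 B)) (hα' : Tendsto (fun k => α (ν k + 1)) l (𝓝 A')) :
    Tendsto (fun k => rowForm α β (w k) (ν k)) l (𝓝 (u.1 * A + u.2.1 * B + u.2.2 * A')) :=
  ((hw.fst_nhds.mul hα.ofReal).add (hw.snd_nhds.fst_nhds.mul hβ.ofReal)).add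
    (hw.snd_nhds.snd_nhds.mul hα'.ofReal)

/-- `u` is a limit of multiples of the vectors `v N` along a subsequence. -/
def IsLimitDirection (v : ℕ → ℂ × ℂ × ℂ) (u : ℂ × ℂ × ℂ) : Prop :=
  ∃ (c : ℕ → ℂ) (φ : ℕ → ℕ), Tendsto φ atTop atTop ∧
    Tendsto (fun k => c (φ k) • v (φ k)) atTop (𝓝 u)

lemma exists_isLimitDirection (hv : ∃ᶠ N in atTop, v N ≠ 0) : ∃ u ≠ 0, IsLimitDirection v u := by
  obtain ⟨φ, hφ, hne⟩ := extraction_of_frequently_atTop hv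
  set c : ℕ → ℂ := fun N => (‖v N‖⁻¹ : ℝ)
  have hmem : ∀ k, c (φ k) • v (φ k) ∈ Metric.sphere (0 : ℂ × ℂ × ℂ) 1 := fun k => by
    have : ‖v (φ k)‖ ≠ 0 := norm_ne_zero_iff.2 (hne k)
    simp [c, norm_smul, this]
  obtain ⟨u, hu, ψ, hψ, hlim⟩ := (isCompact_sphere (0 : ℂ × ℂ × ℂ) 1).tendsto_subseq hmem
  refine ⟨u, ?_, c, φ ∘ ψ, (hφ.comp hψ).tendsto_atTop, hlim⟩
  rintro rfl
  simp at hu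

/-- Second differences turn the symmetry of the rows into a limit that does not depend on `m`. -/
lemma HasSymmetricRows.exists_eval_eq_rowForm (hs : HasSymmetricRows α β v)
    (hu : IsLimitDirection v u) {A B : ℝ} (hα : Tendsto ((fwdDiff 1)^[2] α) atTop (𝓝 A))
    (hβ : Tendsto ((fwdDiff 1)^[2] β) atTop (𝓝 B)) :
    ∃ q : ℂ[X], ∀ m : ℕ, rowForm α β u m = q.eval (m : ℂ) := by
  obtain ⟨c, φ, hφ, hlim⟩ := hu
  refine exists_eval_eq_of_fwdDiff_iter_two_eq_const (E := u.1 * A + u.2.1 * B + u.2.2 * A)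
    fun m => ?_
  rw [fwdDiff_iter_two_rowForm]
  have hν : Tendsto (fun k => φ k - (m + 3)) atTop atTop := (tendsto_sub_atTop_nat _).comp hφ
  have hν' := (tendsto_add_atTop_nat 1).comp hν
  refine tendsto_nhds_unique
    (tendsto_rowForm hlim tendsto_const_nhds tendsto_const_nhds tendsto_const_nhds)
    ((tendsto_rowForm hlim (ν := fun k => φ k - (m + 3)) (hα.comp hν) (hβ.comp hν')
      (hα.comp hν')).congr' ?_)
  filter_upwards [hφ.eventually_ge_atTop (m + 3)] with k hk
  have := (hs.smul c).fwdDiff_iter_two m (φ k - (m + 3))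
  rwa [show m + (φ k - (m + 3)) + 3 = φ k by omega] at this

/-- If `β` dominates `α`, then a limit direction is not along the second axis. -/
lemma HasSymmetricRows.fst_ne_zero_or_of_isBigO (hs : HasSymmetricRows α β v)
    (hu : IsLimitDirection v u) (hu0 : u ≠ 0) {g : ℕ → ℝ} {b : ℝ} (hb : b ≠ 0)
    (hg : Tendsto g atTop atTop) (hα : α =O[atTop] g) (hα' : (fun n => α (n + 1)) =O[atTop] g)
    (hβ : Tendsto (fun n => β (n + 1) / g n) atTop (𝓝 b)) : u.1 ≠ 0 ∨ u.2.2 ≠ 0 := by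
  by_contra! hxz
  obtain ⟨c, φ, hφ, hlim⟩ := hu
  have hν : Tendsto (fun k => φ k - 1) atTop atTop := (tendsto_sub_atTop_nat 1).comp hφ
  have hsmall {w : ℕ → ℂ} (hw : Tendsto w atTop (𝓝 0)) {a : ℕ → ℝ} (ha : a =O[atTop] g) :
      (fun k => w k * a (φ k - 1)) =o[atTop] fun k => g (φ k - 1) := by
    simpa using ((isLittleO_one_iff ℝ).2 hw).mul_isBigO
      (Complex.isBigO_ofReal_left.2 (ha.comp_tendsto hν))
  have hfirst := hsmall (hxz.1 ▸ hlim.fst_nhds) hα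
  have hthird := hsmall (hxz.2 ▸ hlim.snd_nhds.snd_nhds) hα'
  have hrow : (fun k => rowForm α β (c (φ k) • v (φ k)) (φ k - 1)) =o[atTop]
      fun k => g (φ k - 1) := by
    have hbdd := ((tendsto_rowForm hlim (ν := fun _ => 0) (α := α) (β := β) tendsto_const_nhds
      tendsto_const_nhds tendsto_const_nhds).isBigO_one ℝ).trans_isLittleO
      ((isLittleO_one_left_iff ℝ).2 (tendsto_norm_atTop_atTop.comp (hg.comp hν)))
    refine hbdd.congr' ?_ EventuallyEq.rfl
    filter_upwards [hφ.eventually_ge_atTop 1] with k hk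
    have := hs.smul c 0 (φ k - 1)
    rw [show 0 + (φ k - 1) + 1 = φ k by omega] at this
    exact this.symm
  have hsecond : (fun k => c (φ k) * (v (φ k)).2.1 * β (φ k - 1 + 1)) =o[atTop]
      fun k => ((g (φ k - 1) : ℝ) : ℂ) := by
    refine (((hrow.sub hfirst).sub hthird).congr_left fun k => ?_).trans_isBigO
      (Complex.isBigO_ofReal_right.2 (isBigO_refl _ _))
    simp only [rowForm, Prod.smul_fst, Prod.smul_snd, smul_eq_mul]
    ring
  have hy : u.2.1 * b = 0 := by
    refine tendsto_nhds_unique (hlim.snd_nhds.fst_nhds.mul (hβ.comp hν).ofReal)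
      (hsecond.tendsto_div_nhds_zero.congr fun k => ?_)
    simp [mul_div_assoc]
  exact hu0 (Prod.ext hxz.1 (Prod.ext (by simpa [hb] using hy) hxz.2))

end LimitDirection

section Square

lemma eq_of_eval_natCast_eq {R : Type*} [CommRing R] [IsDomain R] [CharZero R] {P Q : R[X]}
    (n₀ : ℕ) (h : ∀ n ≥ n₀, P.eval (n : R) = Q.eval (n : R)) : P = Q := by
  refine eq_of_infinite_eval_eq P Q
    (((Set.Ici_infinite n₀).image (Nat.cast_injective (R := R)).injOn).mono ?_)
  rintro _ ⟨n, hn, rfl⟩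
  exact h n hn

lemma isSquare_mul_of_mul_sq_eq {R : Type*} [CommRing R] [IsDomain R] [IsIntegrallyClosed R]
    {p q u t : R} (hu : u ≠ 0) (h : p * u ^ 2 = q * t ^ 2) : IsSquare (p * q) := by
  have hdvd : u ^ 2 ∣ (q * t) ^ 2 := ⟨p * q, by linear_combination -q * h⟩
  obtain ⟨g, hg⟩ := (IsIntegrallyClosed.pow_dvd_pow_iff two_ne_zero).1 hdvd
  refine ⟨g, mul_right_cancel₀ (pow_ne_zero 2 hu) ?_⟩
  linear_combination q * h + (q * t + u * g) * hg

lemma ne_zero_of_eval_natCast_ne_zero {R : Type*} [CommRing R] {W : R[X]}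
    (hW : ∀ n ≥ 1, W.eval ((n : ℕ) : R) ≠ 0) : W ≠ 0 := by
  rintro rfl
  exact hW 1 le_rfl eval_zero

lemma sq_mul_eval_taylor_eq {R : Type*} [CommRing R] {a : ℕ → R} {P Q : R[X]}
    (ha : ∀ n ≥ 1, a n ^ 2 * Q.eval (n : R) = P.eval (n : R)) (n : ℕ) :
    a (n + 1) ^ 2 * (taylor 1 Q).eval (n : R) = (taylor 1 P).eval (n : R) := by
  simpa [taylor_eval] using ha (n + 1) (by omega)

variable {K : Type*} [Field K] [CharZero K] {a : ℕ → K} {P Q V W : K[X]} {x z : K}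

lemma isSquare_mul_of_eval_eq {T U : K[X]} (n₀ : ℕ) (hU : U ≠ 0)
    (ha : ∀ n ≥ n₀, a n ^ 2 * Q.eval (n : K) = P.eval (n : K))
    (haU : ∀ n ≥ n₀, a n * U.eval (n : K) = T.eval (n : K)) : IsSquare (P * Q) := by
  refine isSquare_mul_of_mul_sq_eq (u := U) (t := T) hU (eq_of_eval_natCast_eq n₀ fun n hn => ?_)
  simp only [eval_mul, eval_pow]
  rw [← ha n hn, ← haU n hn]
  ring

lemma isSquare_mul_of_shift_eq (hz : z ≠ 0)
    (ha : ∀ n ≥ 1, a n ^ 2 * Q.eval (n : K) = P.eval (n : K))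
    (hW : ∀ n ≥ 1, W.eval ((n : ℕ) : K) ≠ 0)
    (hrel : ∀ n ≥ 1, z * a (n + 1) * W.eval (n : K) = V.eval (n : K)) : IsSquare (P * Q) := by
  refine isSquare_mul_of_eval_eq (a := a) (U := C z * taylor (-1) W) (T := taylor (-1) V) 2
    (mul_ne_zero (C_ne_zero.2 hz) ?_) (fun n hn => ha n (by omega)) fun n hn => ?_
  · exact (map_ne_zero_iff _ (taylor_injective (-1))).2 (ne_zero_of_eval_natCast_ne_zero hW)
  · obtain ⟨k, rfl⟩ := Nat.exists_eq_add_of_le' hn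
    have := hrel (k + 1) (by omega)
    simp only [taylor_eval, eval_mul, eval_C]
    rw [show ((k + 2 : ℕ) : K) + -1 = ((k + 1 : ℕ) : K) by push_cast; ring, ← this]
    ring

lemma exists_eq_C_mul_of_mul_taylor_one_eq (hQ : ∀ n ≥ 1, Q.eval ((n : ℕ) : K) ≠ 0)
    (h : P * taylor 1 Q = taylor 1 P * Q) : ∃ c, P = C c * Q := by
  refine ⟨P.eval 1 / Q.eval 1, eq_of_eval_natCast_eq 1 fun n hn => ?_⟩
  rw [eval_mul, eval_C]
  have hQ₁ : Q.eval 1 ≠ 0 := by simpa using hQ 1 le_rfl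
  induction n, hn using Nat.le_induction with
  | base => simp [hQ₁]
  | succ n hn ih =>
    have hn' := congrArg (eval (n : K)) h
    simp only [eval_mul, taylor_eval, ← Nat.cast_add_one] at hn'
    refine mul_right_cancel₀ (hQ n hn) ?_
    rw [← hn', ih]
    ring

lemma isSquare_mul_of_ratio_const (hP : P ≠ 0) (hQ : ∀ n ≥ 1, Q.eval ((n : ℕ) : K) ≠ 0)
    (ha : ∀ n ≥ 1, a n ^ 2 * Q.eval (n : K) = P.eval (n : K)) (hx : x ≠ 0)
    (hrel : ∀ n ≥ 1, x * a n + z * a (n + 1) = 0) : IsSquare (P * Q) := by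
  have hpoly : C (x ^ 2) * (P * taylor 1 Q) = C (z ^ 2) * (taylor 1 P * Q) := by
    refine eq_of_eval_natCast_eq 1 fun n hn => ?_
    simp only [eval_mul, eval_C]
    rw [← ha n hn, ← sq_mul_eval_taylor_eq ha n]
    linear_combination (x * a n - z * a (n + 1)) * eval (n : K) Q * eval (n : K) (taylor 1 Q) *
      hrel n hn
  have hsq : x ^ 2 = z ^ 2 := by
    have hlead := congrArg leadingCoeff hpoly
    simp only [leadingCoeff_mul, leadingCoeff_C, leadingCoeff_taylor] at hlead
    exact mul_right_cancel₀ (mul_ne_zero (leadingCoeff_ne_zero.2 hP)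
      (leadingCoeff_ne_zero.2 (ne_zero_of_eval_natCast_ne_zero hQ))) hlead
  rw [← hsq] at hpoly
  obtain ⟨c, rfl⟩ := exists_eq_C_mul_of_mul_taylor_one_eq hQ
    (mul_left_cancel₀ (C_ne_zero.2 (pow_ne_zero 2 hx)) hpoly)
  have hc : c = a 1 ^ 2 := by
    refine mul_right_cancel₀ (hQ 1 le_rfl) ?_
    rw [ha 1 le_rfl, eval_mul, eval_C]
  exact ⟨C (a 1) * Q, by rw [hc, C_pow]; ring⟩

/-- If `x √R(n) + z √R(n + 1)` is a nonzero rational function, then squaring isolates `√R(n)`. -/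
lemma isSquare_mul_of_add_shift_eq (hV : V ≠ 0) (hx : x ≠ 0)
    (hQ : ∀ n ≥ 1, Q.eval ((n : ℕ) : K) ≠ 0) (hW : ∀ n ≥ 1, W.eval ((n : ℕ) : K) ≠ 0)
    (ha : ∀ n ≥ 1, a n ^ 2 * Q.eval (n : K) = P.eval (n : K))
    (hrel : ∀ n ≥ 1, (x * a n + z * a (n + 1)) * W.eval (n : K) = V.eval (n : K)) :
    IsSquare (P * Q) := by
  have hQ0 := ne_zero_of_eval_natCast_ne_zero hQ
  have hτQ : taylor 1 Q ≠ 0 := (map_ne_zero_iff _ (taylor_injective 1)).2 hQ0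
  have hW0 := ne_zero_of_eval_natCast_ne_zero hW
  refine isSquare_mul_of_eval_eq (a := a) (U := C (2 * x) * V * W * Q * taylor 1 Q)
    (T := V ^ 2 * Q * taylor 1 Q + C (x ^ 2) * W ^ 2 * P * taylor 1 Q -
      C (z ^ 2) * W ^ 2 * taylor 1 P * Q) 1 (by simp [hV, hx, hW0, hQ0, hτQ]) ha fun n hn => ?_
  simp only [eval_mul, eval_add, eval_sub, eval_pow, eval_C]
  rw [← hrel n hn, ← ha n hn, ← sq_mul_eval_taylor_eq ha n]
  ring

theorem isSquare_mul_of_relation (hP : P ≠ 0) (hQ : ∀ n ≥ 1, Q.eval ((n : ℕ) : K) ≠ 0)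
    (ha : ∀ n ≥ 1, a n ^ 2 * Q.eval (n : K) = P.eval (n : K)) (hxz : x ≠ 0 ∨ z ≠ 0)
    (hW : ∀ n ≥ 1, W.eval ((n : ℕ) : K) ≠ 0)
    (hrel : ∀ n ≥ 1, (x * a n + z * a (n + 1)) * W.eval (n : K) = V.eval (n : K)) :
    IsSquare (P * Q) := by
  by_cases hx : x = 0
  · subst hx
    exact isSquare_mul_of_shift_eq (by simpa using hxz) ha hW (by simpa using hrel)
  by_cases hV : V = 0
  · subst hV
    exact isSquare_mul_of_ratio_const hP hQ ha hx fun n hn => by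
      simpa [hW n hn] using hrel n hn
  · exact isSquare_mul_of_add_shift_eq hV hx hQ hW ha hrel

end Square

section Expansion

/-- For `n ≥ 1`, `f n = n ^ j * G (1 / n)` with `G` analytic at `0` and `G 0 = l`; this is how the
growth of square roots of rational functions is recorded. The coefficient `l` may vanish, so `j` is
only an upper bound for the order of growth. -/
def HasExpansion (f : ℕ → ℂ) (j : ℕ) (l : ℂ) : Prop :=
  ∃ G : ℂ → ℂ, AnalyticAt ℂ G 0 ∧ G 0 = l ∧ ∀ n ≥ 1, f n = (n : ℂ) ^ j * G ((n : ℂ)⁻¹)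

namespace HasExpansion

variable {f g p : ℕ → ℂ} {i j : ℕ} {k l : ℂ}

lemma congr (hf : HasExpansion f j l) (hfg : ∀ n ≥ 1, g n = f n) : HasExpansion g j l :=
  let ⟨G, hG, hl, h⟩ := hf
  ⟨G, hG, hl, fun n hn => (hfg n hn).trans (h n hn)⟩

lemma const (l : ℂ) : HasExpansion (fun _ => l) 0 l :=
  ⟨fun _ => l, analyticAt_const, rfl, by simp⟩

lemma natCast_add (r : ℂ) : HasExpansion (fun n => n + r) 1 1 := by
  refine ⟨fun u => 1 + r * u, by fun_prop, by simp, fun n hn => ?_⟩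
  have : (n : ℂ) ≠ 0 := Nat.cast_ne_zero.2 (by omega)
  field_simp

lemma mul (hf : HasExpansion f i k) (hg : HasExpansion g j l) :
    HasExpansion (fun n => f n * g n) (i + j) (k * l) := by
  obtain ⟨F, hF, rfl, hf⟩ := hf
  obtain ⟨G, hG, rfl, hg⟩ := hg
  exact ⟨fun u => F u * G u, hF.mul hG, rfl, fun n hn => by simp only [hf n hn, hg n hn]; ring⟩

lemma const_mul (c : ℂ) (hf : HasExpansion f j l) : HasExpansion (fun n => c * f n) j (c * l) := by
  simpa using (const c).mul hf

lemma add (hf : HasExpansion f j k) (hg : HasExpansion g j l) :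
    HasExpansion (fun n => f n + g n) j (k + l) := by
  obtain ⟨F, hF, rfl, hf⟩ := hf
  obtain ⟨G, hG, rfl, hg⟩ := hg
  exact ⟨fun u => F u + G u, hF.add hG, rfl, fun n hn => by simp only [hf n hn, hg n hn]; ring⟩

lemma of_lt (hf : HasExpansion f i l) (hij : i < j) : HasExpansion f j 0 := by
  obtain ⟨F, hF, -, hf⟩ := hf
  refine ⟨fun u => u ^ (j - i) * F u, by fun_prop, by simp [Nat.sub_ne_zero_of_lt hij],
    fun n hn => ?_⟩
  have hn₀ : (n : ℂ) ≠ 0 := Nat.cast_ne_zero.2 (by omega)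
  simp only [hf n hn, inv_pow]
  rw [← pow_mul_pow_sub _ hij.le]
  field_simp

lemma of_mul_eq (hp : HasExpansion p (i + j) k) (hg : HasExpansion g j l) (hl : l ≠ 0)
    (hg₀ : ∀ n ≥ 1, g n ≠ 0) (hfg : ∀ n ≥ 1, f n * g n = p n) : HasExpansion f i (k / l) := by
  obtain ⟨F, hF, rfl, hp⟩ := hp
  obtain ⟨G, hG, rfl, hg⟩ := hg
  refine ⟨fun u => F u / G u, hF.div hG hl, rfl, fun n hn => mul_right_cancel₀ (hg₀ n hn) ?_⟩
  have hG₀ := hg n hn ▸ hg₀ n hn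
  rw [hfg n hn, hp n hn, hg n hn, pow_add]
  field_simp [right_ne_zero_of_mul hG₀]

lemma multiset_prod (S : Multiset ℂ) :
    HasExpansion (fun n => (S.map fun r => (n : ℂ) + r).prod) S.card 1 := by
  induction S using Multiset.induction_on with
  | empty => simpa using const 1
  | cons r S ih => simpa [add_comm] using (natCast_add r).mul ih

lemma of_sq_eq {α : ℕ → ℝ} (hα : ∀ n, 0 < α n) {κ : ℝ} (hκ : 0 < κ)
    (hp : HasExpansion p (2 * j) κ) (hαp : ∀ n ≥ 1, (α n : ℂ) ^ 2 = p n) :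
    HasExpansion (fun n => (α n : ℂ)) j (√κ : ℝ) := by
  obtain ⟨F, hF, hF₀, hp⟩ := hp
  refine ⟨fun u => F u ^ (2⁻¹ : ℂ),
    hF.cpow analyticAt_const (hF₀ ▸ Complex.ofReal_mem_slitPlane.2 hκ), ?_, fun n hn => ?_⟩
  · simp only [hF₀, Real.sqrt_eq_rpow, Complex.ofReal_cpow hκ.le, one_div, Complex.ofReal_inv,
      Complex.ofReal_ofNat]
  · have hval : F (n : ℂ)⁻¹ = ((α n / (n : ℝ) ^ j : ℝ) : ℂ) ^ 2 := by
      have hn₀' : (n : ℂ) ≠ 0 := Nat.cast_ne_zero.2 (by omega)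
      push_cast
      rw [div_pow, hαp n hn, hp n hn, ← pow_mul, mul_comm j 2]
      field_simp
    have hre : 0 < ((α n / (n : ℝ) ^ j : ℝ) : ℂ).re := div_pos (hα n) (by positivity)
    simp only [hval]
    rw [Complex.sq_cpow_two_inv hre, ← Complex.ofReal_natCast, ← Complex.ofReal_pow,
      ← Complex.ofReal_mul, mul_div_cancel₀ _ (by positivity)]

lemma exists_eq_add_mul (hf : HasExpansion f (j + 1) l) :
    ∃ k g, HasExpansion g j k ∧ ∀ n ≥ 1, f n = (n : ℂ) ^ (j + 1) * l + g n := by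
  obtain ⟨F, hF, rfl, hf⟩ := hf
  obtain ⟨p, hp⟩ := hF
  refine ⟨_, _, ⟨dslope F 0, hp.has_fpower_series_dslope_fslope.analyticAt, rfl, fun n _ => rfl⟩,
    fun n hn => ?_⟩
  have hn₀ : (n : ℂ) ≠ 0 := Nat.cast_ne_zero.2 (by omega)
  have hslope := sub_smul_dslope F 0 (n : ℂ)⁻¹
  rw [sub_zero, smul_eq_mul, inv_mul_eq_iff_eq_mul₀ hn₀] at hslope
  rw [hf n hn, hslope]
  ring

lemma tendsto_div (hf : HasExpansion f j l) :
    Tendsto (fun n : ℕ => f n / (n : ℂ) ^ j) atTop (𝓝 l) := by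
  obtain ⟨F, hF, rfl, hf⟩ := hf
  refine (hF.continuousAt.tendsto.comp tendsto_inv_atTop_nhds_zero_nat).congr' ?_
  filter_upwards [eventually_ge_atTop 1] with n hn
  rw [hf n hn, mul_div_cancel_left₀ _ (pow_ne_zero _ (Nat.cast_ne_zero.2 (by omega)))]
  rfl

lemma tendsto_fwdDiff_iter_two (hf : HasExpansion f 2 l) :
    Tendsto ((fwdDiff 1)^[2] f) atTop (𝓝 (2 * l)) := by
  obtain ⟨k, g, hg, hfg⟩ := hf.exists_eq_add_mul
  obtain ⟨c, e, he, hge⟩ := hg.exists_eq_add_mul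
  have he₀ : Tendsto e atTop (𝓝 c) := by simpa using he.tendsto_div
  have hlim : Tendsto (fun n => 2 * l + (fwdDiff 1)^[2] e n) atTop
      (𝓝 (2 * l + (c - 2 * c + c))) := by
    simp only [fwdDiff_iter_two_apply]
    exact tendsto_const_nhds.add (((he₀.comp (tendsto_add_atTop_nat 2)).sub
      ((he₀.comp (tendsto_add_atTop_nat 1)).const_mul 2)).add he₀)
  rw [show 2 * l + (c - 2 * c + c) = 2 * l by ring] at hlim
  refine hlim.congr' ?_
  filter_upwards [eventually_ge_atTop 1] with n hn
  simp only [fwdDiff_iter_two_apply]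
  rw [hfg n hn, hfg (n + 1) (by omega), hfg (n + 2) (by omega), hge n hn,
    hge (n + 1) (by omega), hge (n + 2) (by omega)]
  push_cast
  ring

end HasExpansion

section Real

variable {f : ℕ → ℝ} {j : ℕ} {l : ℝ}

lemma HasExpansion.tendsto_div_of_real (hf : HasExpansion (fun n => (f n : ℂ)) j l) :
    Tendsto (fun n : ℕ => f n / (n : ℝ) ^ j) atTop (𝓝 l) := by
  rw [← tendsto_ofReal_iff]
  exact_mod_cast hf.tendsto_div

lemma HasExpansion.isBigO (hf : HasExpansion (fun n => (f n : ℂ)) j l) :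
    f =O[atTop] fun n => (n : ℝ) ^ j := by
  refine isBigO_of_div_tendsto_nhds ?_ l hf.tendsto_div_of_real
  filter_upwards [eventually_ge_atTop 1] with n hn h₀
  exact absurd h₀ (pow_ne_zero _ (Nat.cast_ne_zero.2 (by omega)))

lemma HasExpansion.exists_tendsto_fwdDiff_iter_two (hf : HasExpansion (fun n => (f n : ℂ)) j l)
    (hj : j ≤ 2) : ∃ A : ℝ, Tendsto ((fwdDiff 1)^[2] f) atTop (𝓝 A) := by
  have key {A : ℝ} (h : HasExpansion (fun n => (f n : ℂ)) 2 A) :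
      Tendsto ((fwdDiff 1)^[2] f) atTop (𝓝 (2 * A)) := by
    rw [← tendsto_ofReal_iff]
    push_cast
    refine h.tendsto_fwdDiff_iter_two.congr fun n => ?_
    simp only [fwdDiff_iter_two_apply]
    push_cast
    ring
  obtain rfl | hj := hj.eq_or_lt
  · exact ⟨_, key hf⟩
  · exact ⟨_, key (A := 0) (by simpa using hf.of_lt hj)⟩

lemma tendsto_succ_div_natCast : Tendsto (fun n : ℕ => ((n + 1 : ℕ) : ℝ) / n) atTop (𝓝 1) := by
  have := tendsto_inv_atTop_nhds_zero_nat (𝕜 := ℝ) |>.const_add 1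
  rw [add_zero] at this
  refine this.congr' ?_
  filter_upwards [eventually_ge_atTop 1] with n hn
  have : (n : ℝ) ≠ 0 := Nat.cast_ne_zero.2 (by omega)
  push_cast
  field_simp

lemma tendsto_succ_div_pow (hf : Tendsto (fun n : ℕ => f n / (n : ℝ) ^ j) atTop (𝓝 l)) :
    Tendsto (fun n : ℕ => f (n + 1) / (n : ℝ) ^ j) atTop (𝓝 l) := by
  have hmul := (hf.comp (tendsto_add_atTop_nat 1)).mul (tendsto_succ_div_natCast.pow j)
  rw [one_pow, mul_one] at hmul
  refine hmul.congr fun n => ?_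
  have : ((n + 1 : ℕ) : ℝ) ≠ 0 := Nat.cast_ne_zero.2 (by omega)
  simp only [Function.comp_apply, div_pow]
  field_simp

lemma isBigO_succ_pow (hf : f =O[atTop] fun n => (n : ℝ) ^ j) :
    (fun n => f (n + 1)) =O[atTop] fun n => (n : ℝ) ^ j := by
  refine (hf.comp_tendsto (tendsto_add_atTop_nat 1)).trans ?_
  refine isBigO_of_div_tendsto_nhds ?_ 1 ?_
  · filter_upwards [eventually_ge_atTop 1] with n hn h₀
    exact absurd h₀ (pow_ne_zero _ (Nat.cast_ne_zero.2 (by omega)))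
  · exact (one_pow (M := ℝ) j ▸ tendsto_succ_div_natCast.pow j).congr fun n => div_pow _ _ _

end Real

end Expansion

section Criterion

/-- The common shape of the diagonals of all Askey scheme Jacobi matrices, for `n ≥ 1`. -/
def diagForm (c₂ c₁ c₀ K s : ℝ) (n : ℕ) : ℝ :=
  c₂ * n ^ 2 + c₁ * n + c₀ + K / ((2 * n + s - 2) * (2 * n + s))

variable {α β : ℕ → ℝ} {h : ℕ → ℂ} {c₂ c₁ c₀ K s : ℝ} {j : ℕ}

lemma exists_eval_add_eq_diagForm_succ (c₂ c₁ c₀ K s : ℝ) :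
    ∃ D : ℂ[X], ∀ n : ℕ, (diagForm c₂ c₁ c₀ K s (n + 1) : ℂ) =
      D.eval (n : ℂ) + K / ((2 * n + s) * (2 * n + s + 2)) := by
  refine ⟨C (c₂ : ℂ) * (X + 1) ^ 2 + C (c₁ : ℂ) * (X + 1) + C (c₀ : ℂ), fun n => ?_⟩
  simp only [diagForm, eval_add, eval_mul, eval_pow, eval_C, eval_X, eval_one]
  push_cast
  rw [show (2 * ((n : ℂ) + 1) + s - 2) * (2 * (n + 1) + s) = (2 * n + s) * (2 * n + s + 2) by ring]

lemma two_mul_natCast_add_mul_ne_zero (hs : 0 < s) (n : ℕ) :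
    (2 * (n : ℂ) + s) * (2 * n + s + 2) ≠ 0 := by
  have : (2 * (n : ℝ) + s) * (2 * n + s + 2) ≠ 0 := by positivity
  exact_mod_cast this

lemma eq_zero_of_div_eq_eval (hs : 0 < s) {κ : ℂ} {q : ℂ[X]}
    (hq : ∀ n : ℕ, κ / ((2 * n + s) * (2 * n + s + 2)) = q.eval (n : ℂ)) : κ = 0 := by
  have hpoly : C κ = q * ((2 * X + C (s : ℂ)) * (2 * X + C (s : ℂ) + 2)) := by
    refine eq_of_eval_natCast_eq 0 fun n _ => ?_
    simp only [eval_C, eval_mul, eval_add, eval_ofNat, eval_X, ← hq n]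
    rw [div_mul_cancel₀ _ (two_mul_natCast_add_mul_ne_zero hs n)]
  have hpole := congrArg (eval (-(s : ℂ) / 2)) hpoly
  simp only [eval_C, eval_mul, eval_add, eval_ofNat, eval_X] at hpole
  rw [hpole]
  ring

lemma hasExpansion_diagForm_tail (hs : 0 < s) (c₀ K : ℝ) :
    HasExpansion (fun n => (c₀ : ℂ) + K / ((2 * n + s - 2) * (2 * n + s))) 0 c₀ := by
  have hden : HasExpansion (fun n => ((2 : ℂ) * n + s - 2) * (2 * n + s)) 2 4 := by
    have := ((HasExpansion.natCast_add ((s - 2) / 2)).mul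
      (HasExpansion.natCast_add (s / 2))).const_mul 4
    rw [one_mul, mul_one] at this
    exact this.congr fun n _ => by ring
  have hfrac : HasExpansion (fun n => (K : ℂ) / ((2 * n + s - 2) * (2 * n + s))) 0 0 := by
    have hden₀ : ∀ n ≥ 1, ((2 : ℂ) * (n : ℕ) + s - 2) * (2 * n + s) ≠ 0 := fun n hn => by
      obtain ⟨k, rfl⟩ := Nat.exists_eq_add_of_le' hn
      convert two_mul_natCast_add_mul_ne_zero hs k using 1
      push_cast
      ring
    simpa using ((HasExpansion.const (K : ℂ)).of_lt two_pos).of_mul_eq hden (by norm_num) hden₀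
      fun n hn => div_mul_cancel₀ _ (hden₀ n hn)
  simpa using (HasExpansion.const (c₀ : ℂ)).add hfrac

lemma hasExpansion_one_of_eq_diagForm (hs : 0 < s) (hβ : ∀ n ≥ 1, β n = diagForm 0 c₁ c₀ K s n) :
    HasExpansion (fun n => (β n : ℂ)) 1 c₁ := by
  have := ((HasExpansion.natCast_add 0).const_mul (c₁ : ℂ)).add
    ((hasExpansion_diagForm_tail hs c₀ K).of_lt one_pos)
  rw [mul_one, add_zero] at this
  refine this.congr fun n hn => ?_
  rw [hβ n hn, diagForm]
  push_cast
  ring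

lemma hasExpansion_two_of_eq_diagForm (hs : 0 < s) (hβ : ∀ n ≥ 1, β n = diagForm c₂ c₁ c₀ K s n) :
    HasExpansion (fun n => (β n : ℂ)) 2 c₂ := by
  have := (((HasExpansion.natCast_add 0).mul (HasExpansion.natCast_add 0)).const_mul (c₂ : ℂ)).add
    ((hasExpansion_one_of_eq_diagForm hs fun n _ => rfl :
      HasExpansion (fun n => (diagForm 0 c₁ c₀ K s n : ℂ)) 1 c₁).of_lt one_lt_two)
  rw [mul_one, mul_one, add_zero] at this
  refine this.congr fun n hn => ?_
  rw [hβ n hn, diagForm, diagForm]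
  push_cast
  ring

lemma isBigO_natCast_pow_of_le {i : ℕ} (hij : i ≤ j) :
    (fun n : ℕ => (n : ℝ) ^ i) =O[atTop] fun n => (n : ℝ) ^ j :=
  IsBigO.of_norm_eventuallyLE <| (eventually_ge_atTop 1).mono fun n hn => by
    simpa using pow_le_pow_right₀ (Nat.one_le_cast.2 hn) hij

lemma isLimitDirection_fst_ne_zero_or {u : ℂ × ℂ × ℂ} {v : ℕ → ℂ × ℂ × ℂ}
    (hs : HasSymmetricRows α β v) (hu : IsLimitDirection v u) (hu₀ : u ≠ 0)
    (hα : α =O[atTop] fun n => (n : ℝ) ^ j) (hj : j ≠ 0) {b : ℝ} (hb : b ≠ 0)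
    (hβ : HasExpansion (fun n => (β n : ℂ)) j b) : u.1 ≠ 0 ∨ u.2.2 ≠ 0 :=
  hs.fst_ne_zero_or_of_isBigO hu hu₀ hb
    ((tendsto_pow_atTop hj).comp tendsto_natCast_atTop_atTop) hα (isBigO_succ_pow hα)
    (tendsto_succ_div_pow hβ.tendsto_div_of_real)

namespace HankelRows

/-- If `β` is constant from index `1` on, the middle entry of the window can be replaced by `0`, and
the limit direction then has a nonzero outer entry automatically. -/
lemma exists_rowForm_eq_eval_of_const (hr : HankelRows α β h) (hh : h ≠ 0) (hα₀ : ∀ n, α n ≠ 0)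
    (hβ : ∀ n ≥ 1, β n = c₀) {A : ℝ} (hα : Tendsto ((fwdDiff 1)^[2] α) atTop (𝓝 A)) :
    ∃ u : ℂ × ℂ × ℂ, (u.1 ≠ 0 ∨ u.2.2 ≠ 0) ∧
      ∃ q : ℂ[X], ∀ m : ℕ, rowForm α β u m = q.eval (m : ℂ) := by
  set v : ℕ → ℂ × ℂ × ℂ := fun N => (h N, 0, h (N + 2))
  have hv : HasSymmetricRows α β v := fun m n => by
    have := hr.row_succ m n
    simp only [rowForm, window, v, hβ _ (Nat.le_add_left 1 _)] at this ⊢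
    linear_combination this
  have hfreq : ∃ᶠ N in atTop, v N ≠ 0 := fun hev =>
    hh <| hr.eq_zero_of_eventually hα₀ <| hev.mono fun _ hN => congrArg Prod.fst (not_not.1 hN)
  obtain ⟨u, hu₀, hu⟩ := exists_isLimitDirection hfreq
  have hβΔ : Tendsto ((fwdDiff 1)^[2] β) atTop (𝓝 0) := by
    refine tendsto_const_nhds.congr' ?_
    filter_upwards [eventually_ge_atTop 1] with n hn
    rw [fwdDiff_iter_two_apply, hβ _ hn, hβ _ (by omega), hβ _ (by omega)]
    ring
  refine ⟨u, ?_, hv.exists_eval_eq_rowForm hu hα hβΔ⟩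
  obtain ⟨c, φ, -, hlim⟩ := hu
  have hmid : u.2.1 = 0 := tendsto_nhds_unique hlim.snd_nhds.fst_nhds (by simp [v])
  contrapose! hu₀
  exact Prod.ext hu₀.1 (Prod.ext hmid hu₀.2)

theorem exists_rowForm_eq_eval (hr : HankelRows α β h) (hh : h ≠ 0) (hα₀ : ∀ n, α n ≠ 0)
    (hs : 0 < s) (hβ : ∀ n ≥ 1, β n = diagForm c₂ c₁ c₀ K s n)
    (hα : ∃ A : ℝ, Tendsto ((fwdDiff 1)^[2] α) atTop (𝓝 A))
    (hαj : α =O[atTop] fun n => (n : ℝ) ^ j) (hj : j ≤ 2) (hj₁ : c₂ = 0 → j ≤ 1) :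
    ∃ u : ℂ × ℂ × ℂ, (u.1 ≠ 0 ∨ u.2.2 ≠ 0) ∧
      ∃ q : ℂ[X], ∀ m : ℕ, rowForm α β u m = q.eval (m : ℂ) := by
  obtain ⟨A, hα⟩ := hα
  by_cases hconst : c₂ = 0 ∧ c₁ = 0 ∧ K = 0
  · obtain ⟨rfl, rfl, rfl⟩ := hconst
    exact hr.exists_rowForm_eq_eval_of_const hh hα₀ (c₀ := c₀)
      (fun n hn => by simp [hβ n hn, diagForm]) hα
  obtain ⟨u, hu₀, hu⟩ := exists_isLimitDirection (hr.frequently_window_ne_zero hα₀ hh)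
  have hβ₂ := hasExpansion_two_of_eq_diagForm hs hβ
  obtain ⟨B, hβΔ⟩ := hβ₂.exists_tendsto_fwdDiff_iter_two le_rfl
  obtain ⟨q, hq⟩ := hr.row_succ.exists_eval_eq_rowForm hu hα hβΔ
  refine ⟨u, ?_, q, hq⟩
  by_cases h₂ : c₂ = 0
  · subst h₂
    by_cases h₁ : c₁ = 0
    · subst h₁
      have hK : K ≠ 0 := by simpa using hconst
      by_contra! hxz
      obtain ⟨D, hD⟩ := exists_eval_add_eq_diagForm_succ 0 0 c₀ K s
      have hy : u.2.1 * K = 0 := eq_zero_of_div_eq_eval hs (q := q - C u.2.1 * D) fun n => by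
        have := hq n
        rw [rowForm, hxz.1, hxz.2, hβ (n + 1) (by omega), hD] at this
        simp only [eval_sub, eval_mul, eval_C]
        linear_combination this
      have hmid := (mul_eq_zero.1 hy).resolve_right (Complex.ofReal_ne_zero.2 hK)
      exact hu₀ (Prod.ext hxz.1 (Prod.ext hmid hxz.2))
    · exact isLimitDirection_fst_ne_zero_or hr.row_succ hu hu₀
        (hαj.trans (isBigO_natCast_pow_of_le (hj₁ rfl))) one_ne_zero h₁
        (hasExpansion_one_of_eq_diagForm hs hβ)
  · exact isLimitDirection_fst_ne_zero_or hr.row_succ hu hu₀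
      (hαj.trans (isBigO_natCast_pow_of_le hj)) two_ne_zero h₂ hβ₂

theorem isSquare_mul (hr : HankelRows α β h) (hh : h ≠ 0) (hα₀ : ∀ n, α n ≠ 0)
    (hs : 0 < s) (hβ : ∀ n ≥ 1, β n = diagForm c₂ c₁ c₀ K s n)
    (hα : ∃ A : ℝ, Tendsto ((fwdDiff 1)^[2] α) atTop (𝓝 A))
    (hαj : α =O[atTop] fun n => (n : ℝ) ^ j) (hj : j ≤ 2) (hj₁ : c₂ = 0 → j ≤ 1) {P Q : ℂ[X]}
    (hP : P ≠ 0) (hQ : ∀ n ≥ 1, Q.eval ((n : ℕ) : ℂ) ≠ 0)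
    (hαPQ : ∀ n ≥ 1, (α n : ℂ) ^ 2 * Q.eval (n : ℂ) = P.eval (n : ℂ)) : IsSquare (P * Q) := by
  obtain ⟨u, hxz, q, hq⟩ := hr.exists_rowForm_eq_eval hh hα₀ hs hβ hα hαj hj hj₁
  obtain ⟨D, hD⟩ := exists_eval_add_eq_diagForm_succ c₂ c₁ c₀ K s
  set W : ℂ[X] := (2 * X + C (s : ℂ)) * (2 * X + C (s : ℂ) + 2) with hW
  refine isSquare_mul_of_relation hP hQ hαPQ hxz (W := W)
    (V := (q - C u.2.1 * D) * W - C (u.2.1 * K)) ?_ ?_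
  · intro n _
    simpa [hW] using two_mul_natCast_add_mul_ne_zero hs n
  · intro n _
    have hrow := hq n
    have hcancel := div_mul_cancel₀ (K : ℂ) (two_mul_natCast_add_mul_ne_zero hs n)
    rw [rowForm, hβ (n + 1) (by omega), hD] at hrow
    simp only [hW, eval_mul, eval_add, eval_sub, eval_C, eval_X, eval_ofNat]
    linear_combination (2 * (n : ℂ) + s) * (2 * n + s + 2) * hrow - u.2.1 * hcancel

end HankelRows

end Criterion

section EvenMultiplicity

lemma eval_prod_X_add_C (S : Multiset ℂ) (x : ℂ) :
    (S.map fun r => X + C r).prod.eval x = (S.map fun r => x + r).prod := by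
  simp [eval_multiset_prod, Multiset.map_map]

lemma even_count_of_isSquare {k : ℂ} {S : Multiset ℂ}
    (h : IsSquare (C k * (S.map fun r => X + C r).prod)) (hk : k ≠ 0) (r : ℂ) :
    Even (S.count r) := by
  obtain ⟨g, hg⟩ := h
  have hprod : (S.map fun r => X + C r).prod = ((S.map Neg.neg).map fun r => X - C r).prod := by
    simp [Multiset.map_map]
  have hg₀ : g * g ≠ 0 := by
    rw [← hg]
    exact mul_ne_zero (C_ne_zero.2 hk)
      (monic_multiset_prod_of_monic _ _ fun r _ => monic_X_add_C r).ne_zero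
  have hroots : S.map Neg.neg = g.roots + g.roots := by
    rw [← roots_mul hg₀, ← hg, roots_C_mul _ hk, hprod, roots_multiset_prod_X_sub_C]
  rw [← Multiset.count_map_eq_count' _ _ neg_injective, hroots, Multiset.count_add]
  exact ⟨_, rfl⟩

namespace HankelRows

variable {α β : ℕ → ℝ} {h : ℕ → ℂ} {c₂ c₁ c₀ K s κ : ℝ} {j : ℕ}

theorem even_count (hr : HankelRows α β h) (hh : h ≠ 0) (hα : ∀ n, 0 < α n) (hs : 0 < s)
    (hβ : ∀ n ≥ 1, β n = diagForm c₂ c₁ c₀ K s n) (hκ : 0 < κ) (S T : Multiset ℂ)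
    (hcard : S.card = T.card + 2 * j) (hj : j ≤ 2) (hj₁ : c₂ = 0 → j ≤ 1)
    (hT : ∀ n ≥ 1, ∀ r ∈ T, ((n : ℕ) : ℂ) + r ≠ 0)
    (hαST : ∀ n ≥ 1, (α n : ℂ) ^ 2 * (T.map fun r => (n : ℂ) + r).prod =
      κ * (S.map fun r => (n : ℂ) + r).prod) (r : ℂ) :
    Even ((S + T).count r) := by
  have hT₀ : ∀ n ≥ 1, (T.map fun r => ((n : ℕ) : ℂ) + r).prod ≠ 0 := fun n hn =>
    Multiset.prod_ne_zero fun h₀ => by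
      obtain ⟨r, hrT, hr₀⟩ := Multiset.mem_map.1 h₀
      exact hT n hn r hrT hr₀
  have hα_sq : HasExpansion (fun n => (α n : ℂ) ^ 2) (2 * j) κ := by
    have hS := (HasExpansion.multiset_prod S).const_mul (κ : ℂ)
    rw [hcard, add_comm, mul_one] at hS
    simpa using hS.of_mul_eq (HasExpansion.multiset_prod T) one_ne_zero hT₀ hαST
  have hexp := HasExpansion.of_sq_eq hα hκ hα_sq fun n _ => rfl
  have hκ₀ : (κ : ℂ) ≠ 0 := Complex.ofReal_ne_zero.2 hκ.ne'
  refine even_count_of_isSquare (k := κ) ?_ hκ₀ r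
  rw [Multiset.map_add, Multiset.prod_add, ← mul_assoc]
  refine hr.isSquare_mul hh (fun n => (hα n).ne') hs hβ (hexp.exists_tendsto_fwdDiff_iter_two hj)
    hexp.isBigO hj hj₁ (mul_ne_zero (C_ne_zero.2 hκ₀)
      (monic_multiset_prod_of_monic _ _ fun r _ => monic_X_add_C r).ne_zero) ?_ ?_
  · simpa only [eval_prod_X_add_C] using hT₀
  · simpa only [eval_mul, eval_C, eval_prod_X_add_C] using hαST

end HankelRows

lemma exists_eq_cons_two_nsmul {ι : Type*} [DecidableEq ι] {S : Multiset ι} {q : ι}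
    (hS : ∀ r, Even ((q ::ₘ S).count r)) : ∃ N : Multiset ι, S = q ::ₘ 2 • N := by
  obtain ⟨N, hN⟩ := Multiset.exists_smul_of_dvd_count (q ::ₘ S) (k := 2) fun r _ => (hS r).two_dvd
  have hmem : q ∈ N := Multiset.mem_of_mem_nsmul (hN ▸ Multiset.mem_cons_self q S)
  obtain ⟨N, rfl⟩ := Multiset.exists_cons_of_mem hmem
  refine ⟨N, (Multiset.cons_inj_right q).1 ?_⟩
  rw [hN, two_nsmul, two_nsmul, Multiset.add_cons, Multiset.cons_add]

lemma exists_eq_two_nsmul_add_replicate_zero {M : Multiset ℂ}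
    (hM : ∀ W ≠ 0, Even (M.count W)) :
    ∃ N : Multiset ℂ, M = 2 • N + Multiset.replicate (M.card % 2) 0 := by
  obtain ⟨N, hN⟩ := Multiset.exists_smul_of_dvd_count (M.filter (· ≠ 0)) (k := 2) fun W hW => by
    have hW₀ := (Multiset.mem_filter.1 hW).2
    rw [Multiset.count_filter_of_pos (p := (· ≠ 0)) hW₀]
    exact (hM W hW₀).two_dvd
  have hsplit : M = 2 • N + Multiset.replicate (M.count 0) 0 := by
    rw [← hN, ← Multiset.filter_eq', add_comm, Multiset.filter_add_not]
  have hcard : M.card % 2 = M.count 0 % 2 := by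
    have := congrArg Multiset.card hsplit
    rw [Multiset.card_add, Multiset.card_nsmul, Multiset.card_replicate] at this
    omega
  refine ⟨N + Multiset.replicate (M.count 0 / 2) 0, ?_⟩
  rw [nsmul_add, Multiset.nsmul_replicate, add_assoc, ← Multiset.replicate_add, hcard,
    Nat.div_add_mod]
  exact hsplit

lemma count_map_add_add_count_map_sub {ρ : ℂ} (hρ : ρ ≠ 0) (D : Multiset ℂ) (c : ℂ) :
    (D.map fun e => c + e).count (c + ρ) + (D.map fun e => c - e).count (c + ρ) =
      (D.map fun e => e ^ 2).count (ρ ^ 2) := by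
  induction D using Multiset.induction_on with
  | empty => simp
  | cons e D ih =>
    have hadd : c + ρ = c + e ↔ ρ = e := add_right_inj c
    have hsub : c + ρ = c - e ↔ ρ = -e := by rw [sub_eq_add_neg, add_right_inj]
    have hne : ρ = e → ρ ≠ -e := by
      rintro rfl
      exact (neg_ne_self.2 hρ).symm
    simp only [Multiset.map_cons, Multiset.count_cons, hadd, hsub, sq_eq_sq_iff_eq_or_eq_neg, ← ih]
    grind

lemma exists_map_sq_eq_of_even_count {D : Multiset ℂ}
    (hD : ∀ W ≠ 0, Even ((1 / 4 ::ₘ D.map fun e => e ^ 2).count W)) :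
    ∃ N : Multiset ℂ, N.card = (D.card - 1) / 2 ∧ (D.map fun e => e ^ 2) =
      1 / 4 ::ₘ (2 • N + Multiset.replicate ((D.card + 1) % 2) 0) := by
  obtain ⟨N, hN⟩ := exists_eq_two_nsmul_add_replicate_zero hD
  rw [Multiset.card_cons, Multiset.card_map] at hN
  have hmem : (1 / 4 : ℂ) ∈ N := by
    have hmem : (1 / 4 : ℂ) ∈ 2 • N + Multiset.replicate ((D.card + 1) % 2) 0 :=
      hN ▸ Multiset.mem_cons_self _ _
    refine Multiset.mem_of_mem_nsmul ((Multiset.mem_add.1 hmem).resolve_right fun h₀ => ?_)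
    exact absurd (Multiset.eq_of_mem_replicate h₀) (by norm_num)
  obtain ⟨N, rfl⟩ := Multiset.exists_cons_of_mem hmem
  have hsplit : (D.map fun e => e ^ 2) =
      1 / 4 ::ₘ (2 • N + Multiset.replicate ((D.card + 1) % 2) 0) := by
    refine (Multiset.cons_inj_right (1 / 4)).1 ?_
    rw [hN, two_nsmul, two_nsmul, Multiset.add_cons, Multiset.cons_add, Multiset.cons_add,
      Multiset.cons_add]
  have hcard := congrArg Multiset.card hsplit
  rw [Multiset.card_cons, Multiset.card_add, Multiset.card_nsmul, Multiset.card_replicate,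
    Multiset.card_map] at hcard
  exact ⟨N, by omega, hsplit⟩

lemma prod_natCast_add_map_add_map_sub (D : Multiset ℂ) (c : ℂ) (n : ℕ) :
    (((D.map fun e => c + e) + D.map fun e => c - e).map fun r => (n : ℂ) + r).prod =
      (D.map fun e => (n + c) ^ 2 - e ^ 2).prod := by
  rw [Multiset.map_add, Multiset.prod_add, Multiset.map_map, Multiset.map_map,
    ← Multiset.prod_map_mul]
  congr 1
  exact Multiset.map_congr rfl fun e _ => by simp only [Function.comp_apply]; ring

lemma prod_map_sub_sq (D : Multiset ℂ) (w : ℂ) :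
    (D.map fun e => w - e ^ 2).prod = ((D.map fun e => e ^ 2).map fun x => w - x).prod := by
  simp only [Multiset.map_map, Function.comp_apply]

lemma natCast_add_half_add_ne_zero {s : ℝ} (hs : 0 < s) {n : ℕ} (hn : 1 ≤ n) {x : ℝ}
    (hx : -1 ≤ x) : (n : ℂ) + ((s : ℂ) / 2 + x) ≠ 0 := by
  have hn' : (1 : ℝ) ≤ n := Nat.one_le_cast.2 hn
  have : (n : ℝ) + (s / 2 + x) ≠ 0 := by linarith
  exact_mod_cast this

theorem HankelRows.exists_map_sq_eq {α β : ℕ → ℝ} {h : ℕ → ℂ} {c₂ c₁ c₀ K s κ : ℝ} {j : ℕ}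
    (hr : HankelRows α β h) (hh : h ≠ 0) (hα : ∀ n, 0 < α n) (hs : 0 < s)
    (hβ : ∀ n ≥ 1, β n = diagForm c₂ c₁ c₀ K s n) (hκ : 0 < κ) (D : Multiset ℂ)
    (hcard : D.card = 2 + j) (hj : j ≤ 2) (hj₁ : c₂ = 0 → j ≤ 1)
    (hαD : ∀ n ≥ 1, ∀ w : ℂ, w = ((n : ℕ) + (s : ℂ) / 2) ^ 2 →
      (α n : ℂ) ^ 2 * (w * (w - 1 / 4)) = κ * (D.map fun e => w - e ^ 2).prod) :
    ∃ N : Multiset ℂ, N.card = (j + 1) / 2 ∧ (D.map fun e => e ^ 2) =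
      1 / 4 ::ₘ (2 • N + Multiset.replicate ((j + 1) % 2) 0) := by
  set c : ℂ := s / 2
  set T : Multiset ℂ := {0, 1 / 2} with hT
  rw [show (j + 1) / 2 = (D.card - 1) / 2 by omega, show (j + 1) % 2 = (D.card + 1) % 2 by omega]
  refine exists_map_sq_eq_of_even_count fun W hW => ?_
  obtain ⟨ρ, rfl⟩ := IsAlgClosed.exists_pow_nat_eq W two_pos
  have hρ := ne_zero_pow two_ne_zero hW
  have heven := hr.even_count hh hα hs hβ hκ ((D.map fun e => c + e) + D.map fun e => c - e)
    ((T.map fun e => c + e) + T.map fun e => c - e) (j := j) (by simp [hcard, hT]; ring) hj hj₁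
    ?_ (fun n hn => ?_) (c + ρ)
  · rw [add_add_add_comm, ← Multiset.map_add, ← Multiset.map_add, Multiset.count_add,
      count_map_add_add_count_map_sub hρ, hT, Multiset.map_add, Multiset.count_add] at heven
    have hTW : (T.map fun e => e ^ 2).count (ρ ^ 2) = ({1 / 4} : Multiset ℂ).count (ρ ^ 2) := by
      simp only [hT, Multiset.insert_eq_cons, Multiset.map_cons, Multiset.map_singleton, ne_eq,
        OfNat.ofNat_ne_zero, not_false_eq_true, zero_pow, Multiset.count_cons_of_ne hW]
      norm_num
    rwa [← Multiset.singleton_add, add_comm, Multiset.count_add, ← hTW]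
  · intro n hn r hr
    have hpos (x : ℝ) (hx : -1 ≤ x) := natCast_add_half_add_ne_zero hs hn hx
    simp only [hT, Multiset.insert_eq_cons, Multiset.map_cons, Multiset.map_singleton,
      Multiset.mem_add, Multiset.mem_cons, Multiset.mem_singleton, or_assoc] at hr
    rcases hr with rfl | rfl | rfl | rfl
    · simpa using hpos 0 (by norm_num)
    · simpa using hpos (1 / 2) (by norm_num)
    · simpa using hpos 0 (by norm_num)
    · simpa [sub_eq_add_neg] using hpos (-2⁻¹) (by norm_num)
  · rw [prod_natCast_add_map_add_map_sub, prod_natCast_add_map_add_map_sub, hT,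
      ← hαD n hn _ rfl]
    simp only [Multiset.insert_eq_cons, Multiset.map_cons, Multiset.map_singleton,
      Multiset.prod_cons, Multiset.prod_singleton]
    ring

end EvenMultiplicity

section AlternatingHilbert

/-- The sequence whose Hankel matrix is `transformedHilbert t`. -/
def alternatingHilbert (t : ℝ) (k : ℕ) : ℂ := (-1) ^ k / (k + t)

lemma hankelMatrix_alternatingHilbert (t : ℝ) :
    hankelMatrix (alternatingHilbert t) = transformedHilbert t := by
  ext m n
  simp [alternatingHilbert, transformedHilbert, hankelMatrix_apply]

lemma natCast_add_ofReal_ne_zero {t : ℝ} (ht : 0 < t) (k : ℕ) : (k : ℂ) + t ≠ 0 := by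
  have : (k : ℝ) + t ≠ 0 := by positivity
  exact_mod_cast this

lemma eq_zero_of_sum_div_natCast_add_eq_zero {ι : Type*} {s : Finset ι} {c z : ι → ℂ}
    (hz : Set.InjOn z s) (n₀ : ℕ) (hz₀ : ∀ n ≥ n₀, ∀ i ∈ s, (n : ℂ) + z i ≠ 0)
    (hsum : ∀ n ≥ n₀, ∑ i ∈ s, c i / (n + z i) = 0) : ∀ i ∈ s, c i = 0 := by
  classical
  have hpoly : ∑ i ∈ s, C (c i) * ∏ j ∈ s.erase i, (X + C (z j)) = 0 := by
    refine eq_of_eval_natCast_eq n₀ fun n hn => ?_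
    have hclear (i) (hi : i ∈ s) : c i * ∏ j ∈ s.erase i, (n + z j) =
        c i / (n + z i) * ∏ j ∈ s, (n + z j) := by
      rw [← Finset.mul_prod_erase s _ hi]
      field_simp [hz₀ n hn i hi]
    simp only [eval_finsetSum, eval_mul, eval_C, eval_prod, eval_add, eval_X, eval_zero]
    rw [Finset.sum_congr rfl hclear, ← Finset.sum_mul, hsum n hn, zero_mul]
  intro i hi
  have heval := congrArg (eval (-z i)) hpoly
  simp only [eval_finsetSum, eval_mul, eval_C, eval_prod, eval_add, eval_X, eval_zero] at heval
  rw [Finset.sum_eq_single_of_mem i hi] at heval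
  · refine (mul_eq_zero.1 heval).resolve_right (Finset.prod_ne_zero_iff.2 fun j hj => ?_)
    rw [neg_add_eq_sub, sub_ne_zero]
    exact fun hij => (Finset.mem_erase.1 hj).1 (hz (Finset.mem_of_mem_erase hj) hi hij)
  · intro j _ hji
    rw [Finset.prod_eq_zero (Finset.mem_erase.2 ⟨hji.symm, hi⟩) (neg_add_cancel _), mul_zero]

variable {h : ℕ → ℂ} {t : ℝ}

theorem exists_eq_smul_alternatingHilbert (hlim : Tendsto h atTop (𝓝 0)) (ht : 0 < t)
    (hrec : ∀ k : ℕ, (k + t) * h k + 2 * (k + 1 + t) * h (k + 1) + (k + 2 + t) * h (k + 2) = 0) :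
    ∃ κ : ℂ, h = κ • alternatingHilbert t := by
  set e : ℕ → ℂ := fun k => (-1) ^ k * ((k + t) * h k) with he
  have haff (n : ℕ) : e n = e 0 + n * (e 1 - e 0) := by
    refine eq_of_fwdDiff_iter_two_eq (g := fun n : ℕ => e 0 + n * (e 1 - e 0)) (fun k => ?_)
      (by simp) (by simp) n
    simp only [fwdDiff_iter_two_apply, he]
    push_cast
    linear_combination (-1) ^ k * hrec k
  have hslope : e 1 - e 0 = 0 := by
    have hinv := tendsto_inv_atTop_nhds_zero_nat (𝕜 := ℂ)
    have hslope : Tendsto (fun n : ℕ => (n : ℂ)⁻¹ * e 0 + (e 1 - e 0)) atTop (𝓝 (e 1 - e 0)) := by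
      simpa using (hinv.mul_const (e 0)).add_const (e 1 - e 0)
    have hzero : Tendsto (fun n : ℕ => (1 + (n : ℂ)⁻¹ * t) * ((-1) ^ n * h n)) atTop (𝓝 0) := by
      have hsign : Tendsto (fun n : ℕ => (-1 : ℂ) ^ n * h n) atTop (𝓝 0) := by
        rw [tendsto_zero_iff_norm_tendsto_zero] at hlim ⊢
        simpa using hlim
      simpa using ((hinv.mul_const (t : ℂ)).const_add 1).mul hsign
    refine tendsto_nhds_unique hslope (hzero.congr' ?_)
    filter_upwards [eventually_ne_atTop 0] with n hn
    have hn₀ : (n : ℂ) ≠ 0 := Nat.cast_ne_zero.2 hn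
    have := haff n
    simp only [he] at this ⊢
    field_simp
    linear_combination this
  refine ⟨e 0, funext fun k => ?_⟩
  have hk := haff k
  rw [hslope, mul_zero, add_zero] at hk
  have hkt := natCast_add_ofReal_ne_zero ht k
  have hsign : (-1 : ℂ) ^ k * (-1) ^ k = 1 := by rw [← mul_pow]; norm_num
  rw [Pi.smul_apply, smul_eq_mul, ← hk, alternatingHilbert]
  field_simp
  linear_combination -((k + t) * h k) * hsign

lemma exists_eventually_eq_mul_alternatingHilbert (hlim : Tendsto h atTop (𝓝 0))
    (hrec : ∀ᶠ k : ℕ in atTop,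
      (k + t) * h k + 2 * (k + 1 + t) * h (k + 1) + (k + 2 + t) * h (k + 2) = 0) :
    ∃ κ : ℂ, ∀ᶠ k in atTop, h k = κ * alternatingHilbert t k := by
  obtain ⟨k₀, hk₀⟩ := eventually_atTop.1 <|
    hrec.and (tendsto_natCast_atTop_atTop.eventually_gt_atTop (-t))
  obtain ⟨κ, hκ⟩ := exists_eq_smul_alternatingHilbert (t := k₀ + t)
    (h := fun k => h (k + k₀)) ((tendsto_add_atTop_iff_nat k₀).2 hlim)
    (by linarith [(hk₀ k₀ le_rfl).2]) fun k => by
      have := (hk₀ (k + k₀) (by omega)).1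
      rw [add_right_comm k 1, add_right_comm k 2]
      push_cast at this ⊢
      linear_combination this
  refine ⟨κ * (-1) ^ k₀, eventually_atTop.2 ⟨k₀, fun k hk => ?_⟩⟩
  obtain ⟨k, rfl⟩ := Nat.exists_eq_add_of_le' hk
  have hsign : (-1 : ℂ) ^ k₀ * (-1) ^ k₀ = 1 := by rw [← mul_pow]; norm_num
  have hk := congrFun hκ k
  simp only [Pi.smul_apply, smul_eq_mul, alternatingHilbert] at hk ⊢
  push_cast at hk ⊢
  rw [hk, pow_add, add_assoc]
  linear_combination -(κ * (-1) ^ k / (k + (k₀ + t))) * hsign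

lemma eq_zero_of_eventually_alternatingHilbert_relation {u : ℂ × ℂ × ℂ}
    (hu : ∀ᶠ N in atTop, u.1 * alternatingHilbert t N + u.2.1 * alternatingHilbert t (N + 1) +
      u.2.2 * alternatingHilbert t (N + 2) = 0) : u = 0 := by
  obtain ⟨N₀, hN₀⟩ := eventually_atTop.1 <|
    hu.and (tendsto_natCast_atTop_atTop.eventually_gt_atTop (-t))
  have hzero := eq_zero_of_sum_div_natCast_add_eq_zero (s := Finset.univ)
    (c := ![u.1, -u.2.1, u.2.2]) (z := fun j : Fin 3 => (t : ℂ) + (j : ℕ)) ?_ N₀ ?_ fun n hn => ?_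
  · have h₁ := neg_eq_zero.1 (hzero 1 (Finset.mem_univ _))
    exact Prod.ext (hzero 0 (Finset.mem_univ _)) (Prod.ext h₁ (hzero 2 (Finset.mem_univ _)))
  · intro i _ j _ hij
    exact Fin.ext (Nat.cast_injective (add_left_cancel hij))
  · intro n hn i _
    have : (n : ℝ) + (t + (i : ℕ)) ≠ 0 := by linarith [(hN₀ n hn).2, Nat.cast_nonneg (α := ℝ) i]
    exact_mod_cast this
  · have hrel := (hN₀ n hn).1
    simp only [alternatingHilbert, pow_add, pow_one, mul_neg_one, neg_one_sq, mul_one] at hrel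
    push_cast at hrel
    have hsign : (-1 : ℂ) ^ n ≠ 0 := pow_ne_zero n (neg_ne_zero.2 one_ne_zero)
    refine (mul_eq_zero.1 ?_).resolve_left hsign
    simp only [Fin.sum_univ_three, Matrix.cons_val, Fin.val_zero, Fin.val_one, Fin.val_two]
    push_cast
    refine Eq.trans ?_ hrel
    ring_nf

end AlternatingHilbert

section Quadratic

/-- The value at `x = m` of `rowForm α β u` when `α n = γ (n² + (t + 1) n + r)` and
`β n = γ (2 n² + 2 t n) + c₀`, extended to complex `x`. -/
def quadraticRowForm (γ t r c₀ : ℝ) (u : ℂ × ℂ × ℂ) (x : ℂ) : ℂ :=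
  u.1 * (γ * (x ^ 2 + (t + 1) * x + r)) +
    u.2.1 * (γ * (2 * (x + 1) ^ 2 + 2 * t * (x + 1)) + c₀) +
    u.2.2 * (γ * ((x + 1) ^ 2 + (t + 1) * (x + 1) + r))

variable {α β : ℕ → ℝ} {h : ℕ → ℂ} {γ t r c₀ : ℝ}

lemma quadraticRowForm_sub (u : ℂ × ℂ × ℂ) (x y : ℂ) :
    quadraticRowForm γ t r c₀ u x - quadraticRowForm γ t r c₀ u y =
      γ * (x - y) * ((x + y + 1 + t) * u.1 + 2 * (x + y + 1 + 1 + t) * u.2.1 +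
        (x + y + 1 + 2 + t) * u.2.2) := by
  simp only [quadraticRowForm]
  ring

lemma rowForm_eq_quadraticRowForm {n : ℕ} (hα : α n = γ * (n ^ 2 + (t + 1) * n + r))
    (hα' : α (n + 1) = γ * ((n + 1 : ℕ) ^ 2 + (t + 1) * (n + 1 : ℕ) + r))
    (hβ : β (n + 1) = γ * (2 * (n + 1 : ℕ) ^ 2 + 2 * t * (n + 1 : ℕ)) + c₀) (u : ℂ × ℂ × ℂ) :
    rowForm α β u n = quadraticRowForm γ t r c₀ u n := by
  rw [rowForm, quadraticRowForm, hα, hα', hβ]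
  push_cast
  rfl

namespace HankelRows

lemma eventually_recurrence_of_quadratic (hr : HankelRows α β h) (hγ : γ ≠ 0)
    (hα : ∀ᶠ n in atTop, α n = γ * (n ^ 2 + (t + 1) * n + r))
    (hβ : ∀ᶠ n in atTop, β n = γ * (2 * n ^ 2 + 2 * t * n) + c₀) :
    ∀ᶠ k in atTop,
      (k + t) * h k + 2 * (k + 1 + t) * h (k + 1) + (k + 2 + t) * h (k + 2) = 0 := by
  obtain ⟨n₀, hn₀⟩ := eventually_atTop.1 (hα.and hβ)
  have hrow (n) (hn : n ≥ n₀) := rowForm_eq_quadraticRowForm (hn₀ n hn).1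
    (hn₀ (n + 1) (by omega)).1 (hn₀ (n + 1) (by omega)).2
  refine eventually_atTop.2 ⟨2 * n₀ + 2, fun k hk => ?_⟩
  obtain ⟨j, rfl⟩ := Nat.exists_eq_add_of_le hk
  have hsymm := hr.row_succ n₀ (n₀ + 1 + j)
  rw [hrow _ le_rfl, hrow _ (by omega), ← sub_eq_zero, quadraticRowForm_sub,
    show n₀ + (n₀ + 1 + j) + 1 = 2 * n₀ + 2 + j by ring] at hsymm
  have hfactor : (γ : ℂ) * ((n₀ + 1 + j : ℕ) - n₀) ≠ 0 := by
    rw [add_assoc, Nat.cast_add, add_sub_cancel_left, add_comm 1 j]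
    exact mul_ne_zero (Complex.ofReal_ne_zero.2 hγ) (Nat.cast_ne_zero.2 j.succ_ne_zero)
  rw [← (mul_eq_zero.1 hsymm).resolve_left hfactor, window]
  push_cast
  ring

lemma eventually_quadraticRowForm_eq (hr : HankelRows α β h) (hγ : γ ≠ 0)
    (hα : ∀ᶠ n in atTop, α n = γ * (n ^ 2 + (t + 1) * n + r))
    (hβ : ∀ᶠ n in atTop, β n = γ * (2 * n ^ 2 + 2 * t * n) + c₀) :
    ∀ᶠ n in atTop, ∀ N : ℕ, N ≥ n → ∀ x : ℂ, N = x + n + 1 →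
      rowForm α β (window h N) n = quadraticRowForm γ t r c₀ (window h N) x := by
  obtain ⟨n₀, hn₀⟩ := eventually_atTop.1 <|
    (hα.and hβ).and (hr.eventually_recurrence_of_quadratic hγ hα hβ)
  refine eventually_atTop.2 ⟨n₀, fun n hn N hN x hx => ?_⟩
  rw [rowForm_eq_quadraticRowForm (hn₀ n hn).1.1 (hn₀ (n + 1) (by omega)).1.1
    (hn₀ (n + 1) (by omega)).1.2, ← sub_eq_zero, quadraticRowForm_sub, add_comm (n : ℂ) x, ← hx,
    window, (hn₀ N (by omega)).2, mul_zero]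

/-- The equations determine the values at small indices, including `α (-1) = 0`, since three
consecutive terms of `h` satisfy no linear relation with constant coefficients. -/
theorem quadratic_of_eventually (hr : HankelRows α β h) (hγ : γ ≠ 0)
    (hα : ∀ᶠ n in atTop, α n = γ * (n ^ 2 + (t + 1) * n + r))
    (hβ : ∀ᶠ n in atTop, β n = γ * (2 * n ^ 2 + 2 * t * n) + c₀)
    {κ : ℂ} (hκ : κ ≠ 0) (hh : ∀ᶠ k in atTop, h k = κ * alternatingHilbert t k) :
    r = t ∧ (∀ n, α n = γ * (n ^ 2 + (t + 1) * n + r)) ∧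
      ∀ n, β n = γ * (2 * n ^ 2 + 2 * t * n) + c₀ := by
  obtain ⟨N₀, hN₀⟩ := eventually_atTop.1 <|
    (hr.eventually_quadraticRowForm_eq hγ hα hβ).and hh
  have hindep (u : ℂ × ℂ × ℂ) (n₀ : ℕ)
      (hu : ∀ N ≥ n₀, u.1 * h N + u.2.1 * h (N + 1) + u.2.2 * h (N + 2) = 0) : u = 0 := by
    refine eq_zero_of_eventually_alternatingHilbert_relation (t := t) <|
      eventually_atTop.2 ⟨n₀ + N₀, fun N hN => mul_left_cancel₀ hκ ?_⟩
    have := hu N (by omega)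
    rw [(hN₀ N (by omega)).2, (hN₀ (N + 1) (by omega)).2, (hN₀ (N + 2) (by omega)).2] at this
    linear_combination this
  have hsucc (m : ℕ) := hindep (α m - γ * (m ^ 2 + (t + 1) * m + r),
    β (m + 1) - (γ * (2 * (m + 1) ^ 2 + 2 * t * (m + 1)) + c₀),
    α (m + 1) - γ * ((m + 1) ^ 2 + (t + 1) * (m + 1) + r)) (m + N₀ + 1) fun N hN => by
      obtain ⟨j, rfl⟩ := Nat.exists_eq_add_of_le hN
      have hsymm := hr.row_succ m (N₀ + j)
      rw [(hN₀ (N₀ + j) (by omega)).1 _ (by omega) m (by push_cast; ring), quadraticRowForm,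
        rowForm, show m + (N₀ + j) + 1 = m + N₀ + 1 + j by ring] at hsymm
      simp only [window] at hsymm
      linear_combination -hsymm
  have hzero := hindep (γ * (r - t), c₀ - β 0, γ * r - α 0) N₀ fun N hN => by
    have hrow := hr.row_zero N
    rw [(hN₀ N hN).1 N le_rfl (-1) (by ring), quadraticRowForm] at hrow
    simp only [window] at hrow
    linear_combination hrow
  simp only [Prod.mk_eq_zero, sub_eq_zero] at hsucc hzero
  norm_cast at hsucc hzero
  obtain ⟨hr₀, hβ₀, -⟩ := hzero
  have hrt := sub_eq_zero.1 ((mul_eq_zero.1 hr₀).resolve_left hγ)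
  refine ⟨hrt, fun m => by exact_mod_cast (hsucc m).1, fun m => ?_⟩
  cases m with
  | zero => simp [hβ₀]
  | succ m => exact_mod_cast (hsucc m).2.1

theorem exists_eq_smul_alternatingHilbert_of_quadratic (hr : HankelRows α β h) (hα₀ : ∀ n, 0 < α n)
    (hlim : Tendsto h atTop (𝓝 0)) (hγ : 0 < γ)
    (hα : ∀ᶠ n in atTop, α n = γ * (n ^ 2 + (t + 1) * n + r))
    (hβ : ∀ᶠ n in atTop, β n = γ * (2 * n ^ 2 + 2 * t * n) + c₀) :
    ∃ t : ℝ, 0 < t ∧ ∃ κ : ℂ, h = κ • alternatingHilbert t := by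
  obtain ⟨κ, hκ⟩ := exists_eventually_eq_mul_alternatingHilbert hlim
    (hr.eventually_recurrence_of_quadratic hγ.ne' hα hβ)
  rcases eq_or_ne κ 0 with rfl | hκ₀
  · exact ⟨1, one_pos, 0, by
      rw [zero_smul]
      exact hr.eq_zero_of_eventually (fun n => (hα₀ n).ne') (by simpa using hκ)⟩
  obtain ⟨rfl, hα, hβ⟩ := hr.quadratic_of_eventually hγ.ne' hα hβ hκ₀ hκ
  have ht : 0 < r := pos_of_mul_pos_right (by simpa [hα] using hα₀ 0) hγ.le
  refine ⟨r, ht, exists_eq_smul_alternatingHilbert hlim ht fun k => ?_⟩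
  have hrow := hr.row_zero k
  rw [rowForm_eq_quadraticRowForm (hα k) (hα _) (hβ _), hα 0, hβ 0, quadraticRowForm] at hrow
  have hfactor : (γ : ℂ) * (k + 1) ≠ 0 :=
    mul_ne_zero (Complex.ofReal_ne_zero.2 hγ.ne') (Nat.cast_add_one_ne_zero k)
  refine mul_left_cancel₀ hfactor ?_
  simp only [window] at hrow
  push_cast at hrow
  linear_combination hrow

end HankelRows

end Quadratic

namespace HankelRows

variable {α β : ℕ → ℝ} {h : ℕ → ℂ} {γ p c₁ c₀ : ℝ}

theorem eq_zero_of_affine_of_const (hr : HankelRows α β h) (hα₀ : ∀ n, α n ≠ 0)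
    (hlim : Tendsto h atTop (𝓝 0)) (hα : ∀ n ≥ 1, α n = γ * (n + p)) (hβ : ∀ n ≥ 1, β n = c₀) :
    h = 0 := by
  have hγ : (γ : ℂ) ≠ 0 := Complex.ofReal_ne_zero.2 <| by
    rintro rfl
    exact hα₀ 1 (by rw [hα 1 le_rfl, zero_mul])
  have hrec (k : ℕ) : h (k + 4 + 2) = -h (k + 4) := by
    have hrow := hr.row_succ 1 (k + 2)
    simp only [rowForm, window] at hrow
    rw [hα 1 le_rfl, hα _ (by omega), hα _ (by omega), hα _ (by omega), hβ _ (by omega),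
      hβ _ (by omega), show 1 + (k + 2) + 1 = k + 4 by ring] at hrow
    have hfactor : (γ : ℂ) * (k + 1) ≠ 0 := mul_ne_zero hγ (Nat.cast_add_one_ne_zero k)
    refine mul_left_cancel₀ hfactor ?_
    push_cast at hrow
    linear_combination hrow
  have hnorm (k j : ℕ) : ‖h (k + 4 + 2 * j)‖ = ‖h (k + 4)‖ := by
    induction j with
    | zero => rfl
    | succ j ih => rw [← ih, show k + 4 + 2 * (j + 1) = k + 2 * j + 4 + 2 by ring, hrec, norm_neg,
        show k + 2 * j + 4 = k + 4 + 2 * j by ring]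
  refine hr.eq_zero_of_eventually hα₀ ?_
  filter_upwards [eventually_ge_atTop 4] with k hk
  obtain ⟨k, rfl⟩ := Nat.exists_eq_add_of_le' hk
  have hsub : Tendsto (fun j => k + 4 + 2 * j) atTop atTop :=
    tendsto_atTop_mono (fun j => by simp only [id]; omega) tendsto_id
  have hlim' := (hlim.comp hsub).norm
  simp only [Function.comp_apply, hnorm, norm_zero] at hlim'
  exact norm_eq_zero.1 (tendsto_nhds_unique tendsto_const_nhds hlim')

theorem isGeometric_of_const (hr : HankelRows α β h) (hα₀ : ∀ n, α n ≠ 0)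
    (hα : ∀ n ≥ 1, α n = γ) (hβ : ∀ n ≥ 1, β n = c₀) : IsGeometric h := by
  have hzero (hz : ∀ᶠ k in atTop, h k = 0) : IsGeometric h :=
    hr.eq_zero_of_eventually hα₀ hz ▸ IsGeometric.zero
  by_cases h₀ : α 0 = γ
  · have hrow (k : ℕ) : (γ : ℂ) * h k + (c₀ - β 0) * h (k + 1) = 0 := by
      have hα' (n : ℕ) : α n = γ := n.eq_zero_or_pos.elim (fun hn => hn ▸ h₀) (hα n)
      have := hr.row_zero k
      simp only [rowForm, window, hα', hβ (k + 1) (by omega)] at this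
      linear_combination this
    have hγ : (γ : ℂ) ≠ 0 := Complex.ofReal_ne_zero.2 (h₀ ▸ hα₀ 0)
    by_cases hc : (c₀ : ℂ) - β 0 = 0
    · refine hzero (Eventually.of_forall fun k => ?_)
      simpa [hc, hγ] using hrow k
    · refine ⟨-γ / (c₀ - β 0), fun k => ?_⟩
      field_simp
      linear_combination hrow k
  · refine hzero ((eventually_ge_atTop 2).mono fun k hk => ?_)
    obtain ⟨k, rfl⟩ := Nat.exists_eq_add_of_le' hk
    have hrow := hr.row_succ 0 (k + 1)
    simp only [rowForm, window] at hrow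
    rw [hα (0 + 1) le_rfl, hα (k + 1) (by omega), hα (k + 1 + 1) (by omega),
      hβ (0 + 1) le_rfl, hβ (k + 1 + 1) (by omega), show 0 + (k + 1) + 1 = k + 2 by ring] at hrow
    have hne : (γ : ℂ) - α 0 ≠ 0 := sub_ne_zero.2 fun h => h₀ (by exact_mod_cast h.symm)
    refine mul_left_cancel₀ hne ?_
    linear_combination hrow

theorem isGeometric_of_affine (hr : HankelRows α β h) (hlim : Tendsto h atTop (𝓝 0)) (hγ : γ ≠ 0)
    (hα : ∀ n : ℕ, α n = γ * (n + 1)) (hβ : ∀ n : ℕ, β n = c₁ * n + c₀) : IsGeometric h := by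
  have hγ' : (γ : ℂ) ≠ 0 := Complex.ofReal_ne_zero.2 hγ
  refine isGeometric_of_recurrence hlim (b := c₁ / γ) fun k => ?_
  have hrow := hr.row_zero k
  simp only [rowForm, window, hα, hβ] at hrow
  have hfactor : (γ : ℂ) * (k + 1) ≠ 0 := mul_ne_zero hγ' (Nat.cast_add_one_ne_zero k)
  refine mul_left_cancel₀ hfactor ?_
  push_cast at hrow
  have hdiv : (γ : ℂ) * (c₁ / γ) = c₁ := mul_div_cancel₀ _ hγ'
  linear_combination hrow + (k + 1) * h (k + 1) * hdiv

end HankelRows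

section AffineDiagonal

variable {h : ℕ → ℂ}

lemma eq_diagForm_of_affine {β : ℕ → ℝ} {c₁ c₀ : ℝ} (hβ : ∀ n : ℕ, β n = c₁ * n + c₀)
    (n : ℕ) : β n = diagForm 0 c₁ c₀ 0 1 n := by
  rw [hβ, diagForm]
  ring

lemma tendsto_fwdDiff_sqrt : Tendsto (fwdDiff 1 fun n : ℕ => √(n : ℝ)) atTop (𝓝 0) := by
  have hsqrt : Tendsto (fun n : ℕ => √(n : ℝ)) atTop atTop :=
    Real.tendsto_sqrt_atTop.comp tendsto_natCast_atTop_atTop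
  have hsum : Tendsto (fun n : ℕ => √((n + 1 : ℕ) : ℝ) + √(n : ℝ)) atTop atTop :=
    tendsto_atTop_mono (fun n => le_add_of_nonneg_left (Real.sqrt_nonneg _)) hsqrt
  refine hsum.inv_tendsto_atTop.congr fun n => inv_eq_of_mul_eq_one_right ?_
  have h₁ : √((n + 1 : ℕ) : ℝ) ^ 2 = n + 1 := by rw [Real.sq_sqrt (by positivity)]; push_cast; rfl
  have h₀ : √(n : ℝ) ^ 2 = n := Real.sq_sqrt n.cast_nonneg
  rw [fwdDiff]
  linear_combination h₁ - h₀

namespace HankelRows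

variable {α β : ℕ → ℝ} {γ δ c₁ c₀ : ℝ}

theorem isGeometric_of_sqrt_mul (hr : HankelRows α β h) (hlim : Tendsto h atTop (𝓝 0))
    (hγ : 0 < γ) (hδ : 0 < δ) (hα : ∀ n : ℕ, α n = γ * √((n + 1) * (n + δ)))
    (hβ : ∀ n : ℕ, β n = c₁ * n + c₀) : IsGeometric h := by
  by_cases hh : h = 0
  · exact hh ▸ IsGeometric.zero
  have hα₀ (n : ℕ) : 0 < α n := by
    rw [hα]
    positivity
  have hα_sq (n : ℕ) : (α n : ℂ) ^ 2 = (γ ^ 2 : ℝ) * ((n + 1) * (n + δ)) := by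
    have : α n ^ 2 = γ ^ 2 * ((n + 1) * (n + δ)) := by
      rw [hα, mul_pow, Real.sq_sqrt (by positivity)]
    exact_mod_cast this
  have heven := hr.even_count hh hα₀ one_pos (fun n _ => eq_diagForm_of_affine hβ n)
    (sq_pos_of_pos hγ) {1, (δ : ℂ)} 0 (j := 1) (by simp) one_le_two (fun _ => le_rfl) (by simp)
    (fun n _ => by simpa using hα_sq n) 1
  obtain rfl : δ = 1 := by
    by_contra hδ₁
    have hδ₁' : (1 : ℂ) ≠ δ := fun h => hδ₁ (by exact_mod_cast h.symm)
    simp [Multiset.insert_eq_cons, hδ₁'] at heven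
  refine hr.isGeometric_of_affine hlim hγ.ne' (fun n => ?_) hβ
  rw [hα, Real.sqrt_mul_self (by positivity)]

theorem eq_zero_of_sqrt (hr : HankelRows α β h) (hγ : 0 < γ) (hα : ∀ n : ℕ, α n = γ * √(n + 1))
    (hβ : ∀ n : ℕ, β n = c₁ * n + c₀) : h = 0 := by
  by_contra hh
  have hα₀ (n : ℕ) : α n ≠ 0 := by
    rw [hα]
    positivity
  have hΔ : Tendsto ((fwdDiff 1)^[2] α) atTop (𝓝 0) := by
    have hdiff := ((tendsto_add_atTop_iff_nat 2).2 tendsto_fwdDiff_sqrt).sub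
      ((tendsto_add_atTop_iff_nat 1).2 tendsto_fwdDiff_sqrt)
    rw [sub_zero] at hdiff
    rw [← mul_zero γ]
    refine (hdiff.const_mul γ).congr fun n => ?_
    simp only [fwdDiff_iter_two_apply, fwdDiff, hα]
    push_cast
    rw [add_assoc (n : ℝ) 1 1, one_add_one_eq_two]
    ring
  have hbound : α =O[atTop] fun n => (n : ℝ) ^ 1 := by
    refine IsBigO.of_bound (γ * 2) ?_
    filter_upwards [eventually_ge_atTop 1] with n hn
    have hn' : (1 : ℝ) ≤ n := Nat.one_le_cast.2 hn
    have hsqrt : √((n : ℝ) + 1) ≤ 2 * n := Real.sqrt_le_iff.2 ⟨by positivity, by nlinarith⟩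
    rw [hα, pow_one, Real.norm_of_nonneg (by positivity), Real.norm_natCast, mul_assoc]
    gcongr
  have hγ₀ : ((γ ^ 2 : ℝ) : ℂ) ≠ 0 := Complex.ofReal_ne_zero.2 (pow_pos hγ 2).ne'
  have hα_sq (n : ℕ) : (α n : ℂ) ^ 2 = (γ ^ 2 : ℝ) * (n + 1) := by
    have : α n ^ 2 = γ ^ 2 * (n + 1) := by rw [hα, mul_pow, Real.sq_sqrt (by positivity)]
    exact_mod_cast this
  have hsq := hr.isSquare_mul hh hα₀ one_pos (fun n _ => eq_diagForm_of_affine hβ n) ⟨0, hΔ⟩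
    hbound one_le_two (fun _ => le_rfl) (P := C ((γ ^ 2 : ℝ) : ℂ) * (X + C 1)) (Q := 1)
    (mul_ne_zero (C_ne_zero.2 hγ₀) (monic_X_add_C 1).ne_zero)
    (by simp) fun n _ => by simpa using hα_sq n
  have heven := even_count_of_isSquare (S := {1}) (by simpa using hsq) hγ₀ 1
  simp at heven

end HankelRows

theorem isGeometric_of_meixnerPollaczek (hlim : Tendsto h atTop (𝓝 0)) {l φ : ℝ} (hl : 0 < l)
    (hφ₀ : 0 < φ) (hφπ : φ < Real.pi)
    (hr : HankelRows (meixnerPollaczekα l φ) (meixnerPollaczekβ l φ) h) : IsGeometric h := by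
  have hsin := Real.sin_pos_of_pos_of_lt_pi hφ₀ hφπ
  refine hr.isGeometric_of_sqrt_mul hlim (γ := 1 / (2 * Real.sin φ)) (δ := 2 * l)
    (c₁ := -(Real.cos φ / Real.sin φ)) (c₀ := -(l * Real.cos φ / Real.sin φ)) (by positivity)
    (by positivity) (fun n => ?_) fun n => ?_
  · rw [meixnerPollaczekα]
    ring
  · rw [meixnerPollaczekβ]
    ring

theorem isGeometric_of_meixner (hlim : Tendsto h atTop (𝓝 0)) {c b : ℝ} (hc₀ : 0 < c)
    (hc₁ : c < 1) (hb : 0 < b) (hr : HankelRows (meixnerα c b) (meixnerβ c b) h) :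
    IsGeometric h := by
  refine hr.isGeometric_of_sqrt_mul hlim (γ := √c / (1 - c)) (c₁ := (1 + c) / (1 - c))
    (c₀ := b * c / (1 - c)) (by positivity) hb (fun n => ?_) fun n => ?_
  · rw [meixnerα, mul_assoc, Real.sqrt_mul hc₀.le]
    ring
  · rw [meixnerβ]
    ring

theorem isGeometric_of_laguerre (hlim : Tendsto h atTop (𝓝 0)) {p : ℝ} (hp : -1 < p)
    (hr : HankelRows (laguerreα p) (laguerreβ p) h) : IsGeometric h := by
  refine hr.isGeometric_of_sqrt_mul hlim (δ := p + 1) (c₁ := 2) (c₀ := p + 1)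
    one_pos (by linarith) (fun n => ?_) fun n => ?_
  · rw [laguerreα, one_mul, add_assoc (n : ℝ) p 1]
  · rw [laguerreβ]
    ring

theorem eq_zero_of_charlier {a : ℝ} (ha : 0 < a)
    (hr : HankelRows (charlierα a) (charlierβ a) h) : h = 0 := by
  refine hr.eq_zero_of_sqrt (γ := √a) (c₁ := 1) (c₀ := a) (by positivity) (fun n => ?_) fun n => ?_
  · rw [charlierα, Real.sqrt_mul ha.le]
  · rw [charlierβ, one_mul]

theorem eq_zero_of_hermite (hr : HankelRows hermiteα hermiteβ h) : h = 0 := by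
  refine hr.eq_zero_of_sqrt (γ := √(1 / 2)) (c₁ := 0) (c₀ := 0) (by positivity) (fun n => ?_)
    fun n => ?_
  · rw [hermiteα, ← Real.sqrt_mul (by norm_num)]
    congr 1
    ring
  · simp [hermiteβ]

end AffineDiagonal

section ConjugatePairs

open scoped ComplexOrder

/-- The sums of two members of a multiset. For the parameters of the Wilson and continuous dual
Hahn families they are the shifts in the factors of `α n ^ 2`. -/
def pairSums {R : Type*} [AddCommMonoid R] (S : Multiset R) : Multiset R :=
  (S.powersetCard 2).map Multiset.sum

section PairSums

variable {R : Type*} [AddCommMonoid R]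

lemma pairSums_zero : pairSums (0 : Multiset R) = 0 := by
  simp [pairSums, Multiset.powersetCard_zero_right 1]

lemma pairSums_cons (a : R) (S : Multiset R) :
    pairSums (a ::ₘ S) = S.map (a + ·) + pairSums S := by
  rw [pairSums, Multiset.powersetCard_cons, Multiset.map_add, add_comm, Multiset.powersetCard_one,
    Multiset.map_map, Multiset.map_map, pairSums]
  simp

lemma pairSums_three (a b c : R) : pairSums {a, b, c} = {a + b, a + c, b + c} := by
  simp only [Multiset.insert_eq_cons, ← Multiset.cons_zero, pairSums_cons, pairSums_zero,
    Multiset.map_cons, Multiset.map_zero, Multiset.cons_add, zero_add, add_zero]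

lemma pairSums_four (a b c d : R) :
    pairSums {a, b, c, d} = {a + b, a + c, a + d, b + c, b + d, c + d} := by
  simp only [Multiset.insert_eq_cons, ← Multiset.cons_zero, pairSums_cons, pairSums_zero,
    Multiset.map_cons, Multiset.map_zero, Multiset.cons_add, zero_add, add_zero]

end PairSums

namespace ConjPaired

variable {S : Multiset ℂ}

lemma prod_pos (hS : ConjPaired S) (hre : ∀ r ∈ S, 0 < r.re) : 0 < S.prod := by
  have hneg : S.filter (fun r => r.im < 0) = (S.filter fun r => 0 < r.im).map star := by
    conv_lhs => rw [← hS, Multiset.filter_map]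
    simp
  have hlower : ((S.filter fun r => ¬r.im = 0).filter fun r => ¬0 < r.im) =
      S.filter fun r => r.im < 0 := by
    rw [Multiset.filter_filter]
    exact Multiset.filter_congr fun r _ => by
      rw [not_lt, lt_iff_le_and_ne]
  have hupper : ((S.filter fun r => ¬r.im = 0).filter fun r => 0 < r.im) =
      S.filter fun r => 0 < r.im := by
    rw [Multiset.filter_filter]
    exact Multiset.filter_congr fun r _ => and_iff_left_of_imp ne_of_gt
  rw [← Multiset.filter_add_not (fun r => r.im = 0) S,
    ← Multiset.filter_add_not (fun r => 0 < r.im) (S.filter fun r => ¬r.im = 0), hlower, hupper,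
    hneg, Multiset.prod_add, Multiset.prod_add]
  refine mul_pos (Multiset.prod_induction (0 < ·) _ (fun _ _ => mul_pos) one_pos ?_) ?_
  · intro r hr
    obtain ⟨hr, him⟩ := Multiset.mem_filter.1 hr
    exact Complex.pos_iff.2 ⟨hre r hr, him.symm⟩
  · set P := S.filter fun r => 0 < r.im
    have hP : P.prod ≠ 0 := Multiset.prod_ne_zero fun h₀ => by
      simpa using hre 0 (Multiset.mem_of_mem_filter h₀)
    rw [show (P.map star).prod = star P.prod from
      (map_multiset_prod (starMulAut (R := ℂ)) P).symm]
    exact mul_star_self_pos (.of_ne_zero hP)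

lemma map_natCast_add (hS : ConjPaired S) (n : ℕ) : ConjPaired (S.map fun r => (n : ℂ) + r) := by
  rw [ConjPaired]
  conv_rhs => rw [← hS]
  simp only [Multiset.map_map, Function.comp_apply, star_add, star_natCast]

lemma prod_natCast_add_pos (hS : ConjPaired S) (hre : ∀ r ∈ S, 0 < r.re) (n : ℕ) :
    0 < (S.map fun r => (n : ℂ) + r).prod := by
  refine (hS.map_natCast_add n).prod_pos fun r hr => ?_
  obtain ⟨q, hq, rfl⟩ := Multiset.mem_map.1 hr
  rw [Complex.add_re, Complex.natCast_re]
  exact add_pos_of_nonneg_of_pos n.cast_nonneg (hre q hq)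

lemma ofReal_re_sum (hS : ConjPaired S) : (S.sum.re : ℂ) = S.sum := by
  refine Complex.conj_eq_iff_re.1 ?_
  rw [map_multiset_sum]
  exact congrArg Multiset.sum hS

lemma pairSums (hS : ConjPaired S) : ConjPaired (pairSums S) := by
  rw [ConjPaired]
  conv_rhs => rw [← hS]
  rw [AskeyHankel.pairSums, AskeyHankel.pairSums, Multiset.powersetCard_map, Multiset.map_map,
    Multiset.map_map]
  exact Multiset.map_congr rfl fun T _ => map_multiset_sum (starAddEquiv (R := ℂ)) T

end ConjPaired

lemma ofReal_sqrt_re_sq {z : ℂ} (hz : 0 < z) : ((√z.re : ℝ) : ℂ) ^ 2 = z := by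
  obtain ⟨hre, him⟩ := Complex.pos_iff.1 hz
  rw [← Complex.ofReal_pow, Real.sq_sqrt hre.le]
  exact Complex.ext rfl him

lemma sqrt_re_pos {z : ℂ} (hz : 0 < z) : 0 < √z.re :=
  Real.sqrt_pos.2 (Complex.pos_iff.1 hz).1

namespace HankelRows

theorem exists_eq_smul_alternatingHilbert_of_sq_eq_quadratic {α β : ℕ → ℝ} {h : ℕ → ℂ}
    {γ t c₀ : ℝ} {r : ℂ}
    (hr : HankelRows α β h) (hα₀ : ∀ n, 0 < α n) (hlim : Tendsto h atTop (𝓝 0)) (hγ : 0 < γ)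
    (hα : ∀ n ≥ 1, (α n : ℂ) ^ 2 = (γ * (n ^ 2 + (t + 1) * n + r)) ^ 2)
    (hβ : ∀ n ≥ 1, β n = γ * (2 * n ^ 2 + 2 * t * n) + c₀) :
    ∃ t : ℝ, 0 < t ∧ ∃ κ : ℂ, h = κ • alternatingHilbert t := by
  lift r to ℝ using by
    have him : (γ * (((1 : ℕ) : ℂ) ^ 2 + (t + 1) * (1 : ℕ) + r)).im = 0 := by
      rcases sq_eq_sq_iff_eq_or_eq_neg.1 (hα 1 le_rfl) with hα₁ | hα₁
      · rw [← hα₁, Complex.ofReal_im]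
      · rw [← neg_eq_iff_eq_neg.2 hα₁, Complex.neg_im, Complex.ofReal_im, neg_zero]
    simpa [hγ.ne', ← Complex.ofReal_natCast] using him
  have hpos : ∀ᶠ n : ℕ in atTop, 0 < (n : ℝ) ^ 2 + (t + 1) * n + r := by
    filter_upwards [(tendsto_natCast_atTop_atTop (R := ℝ)).eventually_gt_atTop (|t + 1| + |r|),
      eventually_ge_atTop 1] with n hn hn₁
    have hn₁ : (1 : ℝ) ≤ n := Nat.one_le_cast.2 hn₁
    nlinarith [neg_abs_le (t + 1), neg_abs_le r, abs_nonneg r]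
  refine hr.exists_eq_smul_alternatingHilbert_of_quadratic (r := r) hα₀ hlim hγ ?_
    (eventually_atTop.2 ⟨1, fun n hn => hβ n hn⟩)
  filter_upwards [hpos, eventually_ge_atTop 1] with n hn hn₁
  exact (sq_eq_sq₀ (hα₀ n).le (by positivity)).1 (by exact_mod_cast hα n hn₁)

end HankelRows

end ConjugatePairs

section ContDualHahn

open scoped ComplexOrder

variable {a b c : ℂ}

lemma ContDualHahnAdmissible.re_pos (hadm : ContDualHahnAdmissible a b c) :
    ∀ r ∈ pairSums {a, b, c}, 0 < r.re := by
  obtain ⟨-, ⟨ha, hb, hc⟩ | ⟨a', b', c', hperm, -, ha, hb, hc⟩⟩ := hadm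
  · rw [pairSums_three]
    simp only [Multiset.insert_eq_cons, Multiset.mem_cons, Multiset.mem_singleton]
    rintro r (rfl | rfl | rfl) <;> rw [Complex.add_re] <;> linarith
  · rw [← hperm, pairSums_three]
    rw [Complex.add_re] at hb hc
    simp only [Multiset.insert_eq_cons, Multiset.mem_cons, Multiset.mem_singleton]
    rintro r (rfl | rfl | rfl) <;> rw [Complex.add_re] <;> linarith

lemma contDualHahnA_mul_contDualHahnC (a b c : ℂ) (n : ℕ) :
    contDualHahnA a b c n * contDualHahnC a b c (n + 1) =
      (n + 1) * ((pairSums {a, b, c}).map fun r => (n : ℂ) + r).prod := by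
  rw [pairSums_three, contDualHahnA, contDualHahnC]
  simp only [Multiset.insert_eq_cons, Multiset.map_cons, Multiset.map_singleton,
    Multiset.prod_cons, Multiset.prod_singleton]
  push_cast
  ring

lemma ContDualHahnAdmissible.mul_pos (hadm : ContDualHahnAdmissible a b c) (n : ℕ) :
    0 < contDualHahnA a b c n * contDualHahnC a b c (n + 1) := by
  rw [contDualHahnA_mul_contDualHahnC]
  exact _root_.mul_pos (mod_cast n.cast_add_one_pos)
    (hadm.1.pairSums.prod_natCast_add_pos hadm.re_pos n)

lemma ContDualHahnAdmissible.ofReal_re_add (hadm : ContDualHahnAdmissible a b c) :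
    (((a + b + c).re : ℝ) : ℂ) = a + b + c := by
  simpa only [Multiset.insert_eq_cons, Multiset.sum_cons, Multiset.sum_singleton, add_assoc]
    using hadm.1.ofReal_re_sum

lemma ContDualHahnAdmissible.contDualHahnβ_eq (hadm : ContDualHahnAdmissible a b c) (n : ℕ) :
    contDualHahnβ a b c n =
      2 * n ^ 2 + (2 * (a + b + c).re - 1) * n + (a * b + a * c + b * c).re := by
  have hsum : contDualHahnA a b c n + contDualHahnC a b c n - a ^ 2 =
      ((2 * n ^ 2 + (2 * (a + b + c).re - 1) * n : ℝ) : ℂ) + (a * b + a * c + b * c) := by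
    push_cast
    rw [hadm.ofReal_re_add, contDualHahnA, contDualHahnC]
    ring
  rw [contDualHahnβ, hsum, Complex.add_re, Complex.ofReal_re]

theorem exists_eq_smul_alternatingHilbert_of_contDualHahn {h : ℕ → ℂ}
    (hlim : Tendsto h atTop (𝓝 0)) (hh : h ≠ 0) (hadm : ContDualHahnAdmissible a b c)
    (hr : HankelRows (contDualHahnα a b c) (contDualHahnβ a b c) h) :
    ∃ t : ℝ, 0 < t ∧ ∃ κ : ℂ, h = κ • alternatingHilbert t := by
  have hα₀ (n : ℕ) : 0 < contDualHahnα a b c n := sqrt_re_pos (hadm.mul_pos n)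
  have hα_sq (n : ℕ) : (contDualHahnα a b c n : ℂ) ^ 2 =
      (n + 1) * ((pairSums {a, b, c}).map fun r => (n : ℂ) + r).prod := by
    rw [contDualHahnα, ofReal_sqrt_re_sq (hadm.mul_pos n), contDualHahnA_mul_contDualHahnC]
  have heven := hr.even_count hh hα₀ one_pos (c₂ := 2) (K := 0)
    (fun n _ => by rw [hadm.contDualHahnβ_eq, diagForm, zero_div, add_zero]) one_pos
    (1 ::ₘ pairSums {a, b, c}) 0 (j := 2) (by rw [pairSums_three]; rfl) le_rfl
    (fun h₂ => absurd h₂ two_ne_zero) (by simp) fun n _ => by simpa using hα_sq n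
  obtain ⟨N, hN⟩ := exists_eq_cons_two_nsmul (by simpa only [add_zero] using heven)
  obtain ⟨q, rfl⟩ : ∃ q, N = {q} := Multiset.card_eq_one.1 <| by
    have hcard := congrArg Multiset.card hN
    rw [pairSums_three, Multiset.card_cons, Multiset.card_nsmul] at hcard
    have : 3 = 2 * N.card + 1 := hcard
    omega
  have hq : (((a + b + c).re : ℝ) : ℂ) = 1 / 2 + q := by
    have hsum := congrArg Multiset.sum hN
    rw [pairSums_three] at hsum
    simp only [Multiset.insert_eq_cons, Multiset.sum_cons, Multiset.sum_singleton,
      Multiset.sum_nsmul, nsmul_eq_mul, Nat.cast_ofNat] at hsum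
    rw [hadm.ofReal_re_add]
    linear_combination hsum / 2
  refine hr.exists_eq_smul_alternatingHilbert_of_sq_eq_quadratic (t := (a + b + c).re - 1 / 2)
    (r := q) (c₀ := (a * b + a * c + b * c).re) hα₀ hlim one_pos (fun n _ => ?_) fun n _ => ?_
  · rw [hα_sq, hN]
    simp only [Multiset.map_cons, Multiset.prod_cons, Multiset.map_nsmul, Multiset.map_singleton,
      Multiset.prod_nsmul, Multiset.prod_singleton]
    push_cast
    rw [hq]
    ring
  · rw [hadm.contDualHahnβ_eq]
    ring

end ContDualHahn

section CommonWeight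

/-- The factor of `α n ^ 2` that the Wilson, continuous Hahn and Jacobi families have in common.
At `n = 0` the factor `s - 1` of the numerator and of the denominator has been cancelled. -/
def commonWeight (s : ℝ) : ℕ → ℝ
  | 0 => 1 / (s ^ 2 * (s + 1))
  | n@(_ + 1) => (n + 1) * (n + s - 1) / ((2 * n + s - 1) * (2 * n + s) ^ 2 * (2 * n + s + 1))

lemma commonWeight_pos {s : ℝ} (hs : 0 < s) : ∀ n, 0 < commonWeight s n
  | 0 => by rw [commonWeight]; positivity
  | k + 1 => by
    have hnum : 0 < ((k + 1 : ℕ) : ℝ) + s - 1 := by push_cast; linarith [k.cast_nonneg (α := ℝ)]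
    have hden : 0 < 2 * ((k + 1 : ℕ) : ℝ) + s - 1 := by
      push_cast; linarith [k.cast_nonneg (α := ℝ)]
    rw [commonWeight]
    positivity

lemma commonWeight_mul {s : ℝ} (hs : 0 < s) {n : ℕ} (hn : 1 ≤ n) {w : ℂ}
    (hw : w = (n + s / 2) ^ 2) :
    (commonWeight s n : ℂ) * (w * (w - 1 / 4)) = 1 / 16 * (w - (1 - s / 2) ^ 2) := by
  have hweight : commonWeight s n * ((2 * n + s - 1) * (2 * n + s) ^ 2 * (2 * n + s + 1)) =
      (n + 1) * (n + s - 1) := by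
    obtain ⟨k, rfl⟩ := Nat.exists_eq_add_of_le' hn
    have hden : 0 < 2 * ((k + 1 : ℕ) : ℝ) + s - 1 := by
      push_cast; linarith [k.cast_nonneg (α := ℝ)]
    exact div_mul_cancel₀ _ (by positivity)
  have hweight := congrArg (Complex.ofReal) hweight
  push_cast at hweight
  rw [hw]
  linear_combination hweight / 16

lemma mul_sub_one_quarter_ne_zero {s : ℝ} (hs : 0 < s) {n : ℕ} (hn : 1 ≤ n) :
    ((n : ℂ) + s / 2) ^ 2 * ((n + s / 2) ^ 2 - 1 / 4) ≠ 0 := by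
  have hn₁ : (1 : ℝ) ≤ n := Nat.one_le_cast.2 hn
  have hpos : 0 < ((n : ℝ) + s / 2) ^ 2 * ((n + s / 2) ^ 2 - 1 / 4) := by
    refine mul_pos (by positivity) ?_
    nlinarith
  simpa only [Complex.ofReal_mul, Complex.ofReal_sub, Complex.ofReal_pow, Complex.ofReal_add,
    Complex.ofReal_div, Complex.ofReal_natCast, Complex.ofReal_one, Complex.ofReal_ofNat]
    using Complex.ofReal_ne_zero.2 hpos.ne'

end CommonWeight

section Wilson

open scoped ComplexOrder

variable {a b c d : ℂ}

lemma WilsonAdmissible.re_pos (hadm : WilsonAdmissible a b c d) :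
    ∀ r ∈ pairSums {a, b, c, d}, 0 < r.re := by
  obtain ⟨-, ⟨ha, hb, hc, hd⟩ | ⟨a', b', c', d', hperm, -, ha, hb, hc, hd⟩⟩ := hadm
  · rw [pairSums_four]
    simp only [Multiset.insert_eq_cons, Multiset.mem_cons, Multiset.mem_singleton]
    rintro r (rfl | rfl | rfl | rfl | rfl | rfl) <;> rw [Complex.add_re] <;> linarith
  · rw [← hperm, pairSums_four]
    rw [Complex.add_re] at hb hc hd
    simp only [Multiset.insert_eq_cons, Multiset.mem_cons, Multiset.mem_singleton]
    rintro r (rfl | rfl | rfl | rfl | rfl | rfl) <;> rw [Complex.add_re] <;> linarith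

lemma WilsonAdmissible.ofReal_re_add (hadm : WilsonAdmissible a b c d) :
    (((a + b + c + d).re : ℝ) : ℂ) = a + b + c + d := by
  simpa only [Multiset.insert_eq_cons, Multiset.sum_cons, Multiset.sum_singleton, add_assoc]
    using hadm.1.ofReal_re_sum

lemma WilsonAdmissible.re_add_pos (hadm : WilsonAdmissible a b c d) : 0 < (a + b + c + d).re := by
  have hre := hadm.re_pos
  rw [pairSums_four] at hre
  rw [add_assoc, Complex.add_re]
  exact add_pos (hre _ (by simp)) (hre _ (by simp))

lemma wilsonA_mul_wilsonC {s : ℝ} (hs : (s : ℂ) = a + b + c + d) (n : ℕ) :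
    wilsonA a b c d n * wilsonC a b c d (n + 1) =
      commonWeight s n * ((pairSums {a, b, c, d}).map fun r => (n : ℂ) + r).prod := by
  rw [pairSums_four]
  simp only [Multiset.insert_eq_cons, Multiset.map_cons, Multiset.map_singleton,
    Multiset.prod_cons, Multiset.prod_singleton]
  have hshift (x y : ℂ) : ((n + 1 : ℕ) : ℂ) + x + y - 1 = n + (x + y) := by push_cast; ring
  have hden : (2 * ((n + 1 : ℕ) : ℂ) + a + b + c + d - 2) *
      (2 * ((n + 1 : ℕ) : ℂ) + a + b + c + d - 1) = (2 * n + s) * (2 * n + s + 1) := by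
    rw [hs]; push_cast; ring
  rw [wilsonC, hshift, hshift, hshift, hden]
  rcases n with _ | k
  · rw [wilsonA, commonWeight, ← hs, div_mul_div_comm]
    simp only [Nat.cast_zero, zero_add, mul_zero]
    generalize a + b = p₁, a + c = p₂, a + d = p₃, b + c = p₄, b + d = p₅, c + d = p₆
    push_cast
    ring
  · have hsum (x : ℂ) : x + a + b + c + d = x + s := by rw [hs]; ring
    rw [wilsonA, commonWeight, hsum, hsum, add_assoc _ a b, add_assoc _ a c, add_assoc _ a d,
      div_mul_div_comm]
    generalize ((k + 1 : ℕ) : ℂ) + (a + b) = p₁, ((k + 1 : ℕ) : ℂ) + (a + c) = p₂,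
      ((k + 1 : ℕ) : ℂ) + (a + d) = p₃, ((k + 1 : ℕ) : ℂ) + (b + c) = p₄,
      ((k + 1 : ℕ) : ℂ) + (b + d) = p₅, ((k + 1 : ℕ) : ℂ) + (c + d) = p₆
    push_cast
    ring

lemma WilsonAdmissible.mul_pos (hadm : WilsonAdmissible a b c d) (n : ℕ) :
    0 < wilsonA a b c d n * wilsonC a b c d (n + 1) := by
  rw [wilsonA_mul_wilsonC hadm.ofReal_re_add]
  exact _root_.mul_pos (Complex.zero_lt_real.2 (commonWeight_pos hadm.re_add_pos n))
    (hadm.1.pairSums.prod_natCast_add_pos hadm.re_pos n)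

lemma wilson_partial_fractions {u e₀ e₁ e₂ e₃ : ℂ} (hu : u ≠ 0) (hu₁ : u + 1 ≠ 0)
    (hu₂ : u + 2 ≠ 0) :
    (u / 2 + 1 + e₁) * (u / 2 + 1 + e₂) * (u / 2 + 1 + e₃) * (u / 2 + 1 - e₀) /
        ((u + 1) * (u + 2)) +
      (u / 2 + e₀) * (u / 2 - e₁) * (u / 2 - e₂) * (u / 2 - e₃) / (u * (u + 1)) =
    u ^ 2 / 8 + u / 4 + (1 + (e₁ + e₂ + e₃ - e₀) + (e₁ * e₂ + e₁ * e₃ + e₂ * e₃) -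
      e₀ * (e₁ + e₂ + e₃)) / 2 + -2 * (e₀ * e₁ * e₂ * e₃) / (u * (u + 2)) := by
  field_simp
  ring

lemma wilsonA_add_wilsonC {u e₀ e₁ e₂ e₃ : ℂ} {n : ℕ} (hn : 1 ≤ n)
    (he₀ : e₀ = 1 - (a + b + c + d) / 2) (he₁ : e₁ = (a + b - c - d) / 2)
    (he₂ : e₂ = (a + c - b - d) / 2) (he₃ : e₃ = (a + d - b - c) / 2)
    (hu : u = 2 * n + (a + b + c + d) - 2) (hu₀ : u ≠ 0) (hu₁ : u + 1 ≠ 0) (hu₂ : u + 2 ≠ 0) :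
    wilsonA a b c d n + wilsonC a b c d n =
      u ^ 2 / 8 + u / 4 + (1 + (e₁ + e₂ + e₃ - e₀) + (e₁ * e₂ + e₁ * e₃ + e₂ * e₃) -
        e₀ * (e₁ + e₂ + e₃)) / 2 + -2 * (e₀ * e₁ * e₂ * e₃) / (u * (u + 2)) := by
  rw [← wilson_partial_fractions hu₀ hu₁ hu₂]
  obtain ⟨k, rfl⟩ := Nat.exists_eq_add_of_le' hn
  rw [wilsonA, wilsonC]
  generalize ((k + 1 : ℕ) : ℂ) = n at hu ⊢
  rw [show n + a + b = u / 2 + 1 + e₁ by rw [hu, he₁]; ring,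
    show n + a + c = u / 2 + 1 + e₂ by rw [hu, he₂]; ring,
    show n + a + d = u / 2 + 1 + e₃ by rw [hu, he₃]; ring,
    show u / 2 + 1 + e₁ + c + d - 1 = u / 2 + 1 - e₀ by rw [he₀, he₁]; ring,
    show n + b + c - 1 = u / 2 - e₃ by rw [hu, he₃]; ring,
    show n + b + d - 1 = u / 2 - e₂ by rw [hu, he₂]; ring,
    show n + c + d - 1 = u / 2 - e₁ by rw [hu, he₁]; ring,
    show 2 * n + a + b + c + d - 2 = u by rw [hu]; ring,
    show 2 * n + a + b + c + d - 1 = u + 1 by rw [hu]; ring,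
    show 2 * n + a + b + c + d = u + 2 by rw [hu]; ring,
    show n = u / 2 + e₀ by rw [hu, he₀]; ring]
  ring

/-- The numbers `e` such that `α n ^ 2` is, up to a factor common to all parameters, the product
of the `(n + s / 2) ^ 2 - e ^ 2`, where `s = a + b + c + d`. -/
def wilsonShifts (a b c d : ℂ) : Multiset ℂ :=
  {1 - (a + b + c + d) / 2, (a + b - c - d) / 2, (a + c - b - d) / 2, (a + d - b - c) / 2}

lemma exists_wilsonβ_eq_diagForm {s : ℝ} (hs₀ : 0 < s) (hs : (s : ℂ) = a + b + c + d) :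
    ∃ c₀ : ℝ, ∀ n ≥ 1, wilsonβ a b c d n = diagForm (1 / 2) ((s - 1) / 2) c₀
      (-2 * (wilsonShifts a b c d).prod).re s n := by
  set e₀ : ℂ := 1 - s / 2 with he₀
  set e₁ := (a + b - c - d) / 2 with he₁
  set e₂ := (a + c - b - d) / 2 with he₂
  set e₃ := (a + d - b - c) / 2 with he₃
  set c₀ : ℂ := (1 + (e₁ + e₂ + e₃ - e₀) + (e₁ * e₂ + e₁ * e₃ + e₂ * e₃) -
    e₀ * (e₁ + e₂ + e₃)) / 2 - a ^ 2 + (s / 2 - 1) * s / 4 with hc₀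
  refine ⟨c₀.re, fun n hn => ?_⟩
  have hn₁ : (1 : ℝ) ≤ n := Nat.one_le_cast.2 hn
  obtain ⟨u, hu⟩ : ∃ u : ℝ, u = 2 * n + s - 2 := ⟨_, rfl⟩
  have huC : (u : ℂ) = 2 * n + s - 2 := by rw [hu]; push_cast; ring
  have hsum := wilsonA_add_wilsonC (u := u) hn (hs ▸ he₀) he₁ he₂ he₃ (hs ▸ huC)
    (mod_cast (by linarith : u ≠ 0)) (mod_cast (by linarith : u + 1 ≠ 0))
    (mod_cast (by linarith : u + 2 ≠ 0))
  have hAC : wilsonA a b c d n + wilsonC a b c d n - a ^ 2 =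
      ((1 / 2 * n ^ 2 + (s - 1) / 2 * n : ℝ) : ℂ) + c₀ +
        -2 * (e₀ * e₁ * e₂ * e₃) / ((u * (u + 2) : ℝ) : ℂ) := by
    rw [hsum, hc₀]
    push_cast
    rw [huC]
    ring
  have hprod : (wilsonShifts a b c d).prod = e₀ * e₁ * e₂ * e₃ := by
    simp only [wilsonShifts, ← hs, Multiset.insert_eq_cons, Multiset.prod_cons,
      Multiset.prod_singleton, mul_assoc, he₀, he₁, he₂, he₃]
  rw [wilsonβ, hprod, hAC, Complex.add_re, Complex.add_re, Complex.ofReal_re, Complex.div_ofReal_re,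
    diagForm, hu]
  ring

lemma WilsonAdmissible.sq_mul (hadm : WilsonAdmissible a b c d) {s : ℝ} (hs₀ : 0 < s)
    (hs : (s : ℂ) = a + b + c + d) {n : ℕ} (hn : 1 ≤ n) {w : ℂ} (hw : w = (n + s / 2) ^ 2) :
    (wilsonα a b c d n : ℂ) ^ 2 * (w * (w - 1 / 4)) =
      (1 / 16 : ℝ) * ((wilsonShifts a b c d).map fun e => w - e ^ 2).prod := by
  rw [wilsonα, ofReal_sqrt_re_sq (hadm.mul_pos n), wilsonA_mul_wilsonC hs, mul_right_comm,
    commonWeight_mul hs₀ hn hw, pairSums_four, wilsonShifts, ← hs]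
  simp only [Multiset.insert_eq_cons, Multiset.map_cons, Multiset.map_singleton,
    Multiset.prod_cons, Multiset.prod_singleton]
  rw [show w - ((a + b - c - d) / 2) ^ 2 = (n + (a + b)) * (n + (c + d)) by rw [hw, hs]; ring,
    show w - ((a + c - b - d) / 2) ^ 2 = (n + (a + c)) * (n + (b + d)) by rw [hw, hs]; ring,
    show w - ((a + d - b - c) / 2) ^ 2 = (n + (a + d)) * (n + (b + c)) by rw [hw, hs]; ring]
  push_cast
  generalize a + b = p₁, a + c = p₂, a + d = p₃, b + c = p₄, b + d = p₅, c + d = p₆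
  ring

lemma HankelRows.exists_map_sq_wilsonShifts_eq {h : ℕ → ℂ}
    (hr : HankelRows (wilsonα a b c d) (wilsonβ a b c d) h) (hh : h ≠ 0)
    (hadm : WilsonAdmissible a b c d) :
    ∃ E : ℂ, ((wilsonShifts a b c d).map fun e => e ^ 2) = {1 / 4, E, E, 0} := by
  have hs₀ := hadm.re_add_pos
  have hs := hadm.ofReal_re_add
  obtain ⟨c₀, hβ⟩ := exists_wilsonβ_eq_diagForm hs₀ hs
  obtain ⟨N, hcard, hN⟩ := hr.exists_map_sq_eq hh (fun n => sqrt_re_pos (hadm.mul_pos n)) hs₀ hβ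
    (by norm_num) (wilsonShifts a b c d) (j := 2) rfl le_rfl (fun h₂ => by norm_num at h₂)
    fun n hn w hw => hadm.sq_mul hs₀ hs hn hw
  obtain ⟨E, rfl⟩ : ∃ E, N = {E} := Multiset.card_eq_one.1 hcard
  exact ⟨E, hN⟩

theorem exists_eq_smul_alternatingHilbert_of_wilson {h : ℕ → ℂ}
    (hlim : Tendsto h atTop (𝓝 0)) (hh : h ≠ 0) (hadm : WilsonAdmissible a b c d)
    (hr : HankelRows (wilsonα a b c d) (wilsonβ a b c d) h) :
    ∃ t : ℝ, 0 < t ∧ ∃ κ : ℂ, h = κ • alternatingHilbert t := by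
  have hs₀ := hadm.re_add_pos
  have hs := hadm.ofReal_re_add
  obtain ⟨c₀, hβ⟩ := exists_wilsonβ_eq_diagForm hs₀ hs
  obtain ⟨E, hE⟩ := hr.exists_map_sq_wilsonShifts_eq hh hadm
  generalize (a + b + c + d).re = s at hs₀ hs hβ
  have hprod : (wilsonShifts a b c d).prod = 0 := by
    have hsq := congrArg Multiset.prod hE
    rw [Multiset.prod_map_pow, Multiset.map_id'] at hsq
    simpa using hsq
  refine hr.exists_eq_smul_alternatingHilbert_of_sq_eq_quadratic (γ := 1 / 4) (t := s - 1)
    (r := s ^ 2 / 4 - E) (c₀ := c₀) (fun n => sqrt_re_pos (hadm.mul_pos n)) hlim (by norm_num)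
    (fun n hn => ?_) fun n hn => ?_
  · apply mul_right_cancel₀ (mul_sub_one_quarter_ne_zero hs₀ hn)
    rw [hadm.sq_mul hs₀ hs hn rfl, prod_map_sub_sq, hE]
    simp only [Multiset.insert_eq_cons, Multiset.map_cons, Multiset.map_singleton,
      Multiset.prod_cons, Multiset.prod_singleton]
    push_cast
    ring
  · rw [hβ n hn, hprod, mul_zero, Complex.zero_re, diagForm, zero_div]
    ring

end Wilson

section Jacobi

variable {p q : ℝ}

lemma jacobiα_eq_sqrt (p q : ℝ) (n : ℕ) :
    jacobiα p q n = √(4 * commonWeight (p + q + 2) n * ((n + p + 1) * (n + q + 1))) := by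
  rcases n with _ | k <;> rw [jacobiα, commonWeight]
  · congr 1
    push_cast
    ring
  · congr 1
    push_cast
    ring

lemma jacobi_radicand_pos (hp : -1 < p) (hq : -1 < q) (n : ℕ) :
    0 < 4 * commonWeight (p + q + 2) n * ((n + p + 1) * (n + q + 1)) := by
  have hweight : 0 < commonWeight (p + q + 2) n := commonWeight_pos (by linarith) n
  have hp' : 0 < n + p + 1 := by linarith
  have hq' : 0 < n + q + 1 := by linarith
  positivity

lemma jacobiα_pos (hp : -1 < p) (hq : -1 < q) (n : ℕ) : 0 < jacobiα p q n := by
  rw [jacobiα_eq_sqrt]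
  exact Real.sqrt_pos.2 (jacobi_radicand_pos hp hq n)

/-- The numbers `e` such that `α n ^ 2` is, up to a factor common to all parameters, the product
of the `(n + s / 2) ^ 2 - e ^ 2`, where `s = p + q + 2`. -/
def jacobiShifts (p q : ℝ) : Multiset ℂ :=
  {((p : ℂ) + q) / 2, ((p : ℂ) - q) / 2}

lemma jacobiα_sq_mul (hp : -1 < p) (hq : -1 < q) {n : ℕ} (hn : 1 ≤ n) {w : ℂ}
    (hw : w = (n + ((p + q + 2 : ℝ) : ℂ) / 2) ^ 2) :
    (jacobiα p q n : ℂ) ^ 2 * (w * (w - 1 / 4)) =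
      (1 / 4 : ℝ) * ((jacobiShifts p q).map fun e => w - e ^ 2).prod := by
  rw [jacobiα_eq_sqrt, ← Complex.ofReal_pow, Real.sq_sqrt (jacobi_radicand_pos hp hq n).le,
    jacobiShifts]
  have hweight := commonWeight_mul (s := p + q + 2) (by linarith) hn hw
  simp only [Multiset.insert_eq_cons, Multiset.map_cons, Multiset.map_singleton,
    Multiset.prod_cons, Multiset.prod_singleton]
  push_cast at hw hweight ⊢
  linear_combination 4 * (n + p + 1) * (n + q + 1) * hweight -
    1 / 4 * (w - (1 - (p + q + 2) / 2) ^ 2) * hw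

lemma jacobiβ_eq_diagForm (p q : ℝ) :
    ∀ n ≥ 1, jacobiβ p q n = diagForm 0 0 0 (q ^ 2 - p ^ 2) (p + q + 2) n
  | k + 1, _ => by
    rw [jacobiβ, diagForm, show 2 * ((k + 1 : ℕ) : ℝ) + (p + q + 2) - 2 =
      2 * ((k + 1 : ℕ) : ℝ) + p + q by ring]
    ring

theorem isGeometric_of_jacobi {h : ℕ → ℂ} (hp : -1 < p) (hq : -1 < q)
    (hr : HankelRows (jacobiα p q) (jacobiβ p q) h) : IsGeometric h := by
  rcases eq_or_ne h 0 with rfl | hh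
  · exact IsGeometric.zero
  have hs : 0 < p + q + 2 := by linarith
  obtain ⟨N, hcard, hN⟩ := hr.exists_map_sq_eq hh (jacobiα_pos hp hq) hs (jacobiβ_eq_diagForm p q)
    (by norm_num) (jacobiShifts p q) (j := 0) rfl (by norm_num) (fun _ => by norm_num)
    fun n hn w hw => jacobiα_sq_mul hp hq hn hw
  obtain rfl : N = 0 := Multiset.card_eq_zero.1 hcard
  replace hN : (jacobiShifts p q).map (fun e => e ^ 2) = {1 / 4, 0} := by simpa using hN
  have hK : q ^ 2 - p ^ 2 = 0 := by
    have hsq := congrArg Multiset.prod hN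
    rw [Multiset.prod_map_pow, Multiset.map_id', jacobiShifts] at hsq
    have hprod : (((p + q) * (p - q) : ℝ) : ℂ) = 0 := by simpa using hsq
    linear_combination -Complex.ofReal_eq_zero.1 hprod
  refine hr.isGeometric_of_const (γ := 1 / 2) (c₀ := 0) (fun n => (jacobiα_pos hp hq n).ne')
    (fun n hn => ?_) fun n hn => ?_
  · have hsq : (jacobiα p q n : ℂ) ^ 2 = ((1 / 2 : ℝ) : ℂ) ^ 2 := by
      apply mul_right_cancel₀ (mul_sub_one_quarter_ne_zero hs hn)
      rw [jacobiα_sq_mul hp hq hn rfl, prod_map_sub_sq, hN]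
      simp only [Multiset.insert_eq_cons, Multiset.map_cons, Multiset.map_singleton,
        Multiset.prod_cons, Multiset.prod_singleton]
      push_cast
      ring
    exact (sq_eq_sq₀ (jacobiα_pos hp hq n).le (by norm_num)).1 (mod_cast hsq)
  · rw [jacobiβ_eq_diagForm p q n hn, hK, diagForm]
    ring

end Jacobi

section ContHahn

open scoped ComplexOrder

variable {a b c d : ℂ}

lemma ContHahnAdmissible.ofReal_re_add (hadm : ContHahnAdmissible a b c d) :
    (((a + b + c + d).re : ℝ) : ℂ) = a + b + c + d := by
  obtain ⟨rfl, rfl, -, -⟩ := hadm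
  rw [Complex.ext_iff]
  simp

lemma ContHahnAdmissible.re_add_pos (hadm : ContHahnAdmissible a b c d) :
    0 < (a + b + c + d).re := by
  obtain ⟨rfl, rfl, ha, hb⟩ := hadm
  simp only [Complex.star_def, Complex.add_re, Complex.conj_re]
  positivity

lemma contHahnA_mul_contHahnC {s : ℝ} (hs : (s : ℂ) = a + b + c + d) (n : ℕ) :
    -(contHahnA a b c d n * contHahnC a b c d (n + 1)) = commonWeight s n *
      (({a + c, b + d, a + d, b + c} : Multiset ℂ).map fun r => (n : ℂ) + r).prod := by
  simp only [Multiset.insert_eq_cons, Multiset.map_cons, Multiset.map_singleton,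
    Multiset.prod_cons, Multiset.prod_singleton]
  have hshift (x y : ℂ) : ((n + 1 : ℕ) : ℂ) + x + y - 1 = n + (x + y) := by push_cast; ring
  have hden : (2 * ((n + 1 : ℕ) : ℂ) + a + b + c + d - 2) *
      (2 * ((n + 1 : ℕ) : ℂ) + a + b + c + d - 1) = (2 * n + s) * (2 * n + s + 1) := by
    rw [hs]; push_cast; ring
  rw [contHahnC, hshift, hshift, hden]
  rcases n with _ | k
  · rw [contHahnA, commonWeight, ← hs, neg_mul, neg_neg, div_mul_div_comm]
    simp only [Nat.cast_zero, zero_add, mul_zero]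
    generalize a + c = p₁, a + d = p₂, b + c = p₃, b + d = p₄
    push_cast
    ring
  · have hsum (x : ℂ) : x + a + b + c + d = x + s := by rw [hs]; ring
    rw [contHahnA, commonWeight, hsum, hsum, add_assoc _ a c, add_assoc _ a d, neg_mul, neg_neg,
      div_mul_div_comm]
    generalize ((k + 1 : ℕ) : ℂ) + (a + c) = p₁, ((k + 1 : ℕ) : ℂ) + (a + d) = p₂,
      ((k + 1 : ℕ) : ℂ) + (b + c) = p₃, ((k + 1 : ℕ) : ℂ) + (b + d) = p₄
    push_cast
    ring

lemma ContHahnAdmissible.mul_pos (hadm : ContHahnAdmissible a b c d) (n : ℕ) :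
    0 < -(contHahnA a b c d n * contHahnC a b c d (n + 1)) := by
  rw [contHahnA_mul_contHahnC hadm.ofReal_re_add]
  refine _root_.mul_pos (Complex.zero_lt_real.2 (commonWeight_pos hadm.re_add_pos n)) ?_
  obtain ⟨rfl, rfl, ha, hb⟩ := hadm
  refine ConjPaired.prod_natCast_add_pos ?_ (fun r hr => ?_) n
  · simp only [ConjPaired, Multiset.insert_eq_cons, Multiset.map_cons, Multiset.map_singleton,
      star_add, star_star, add_comm (star a), add_comm (star b)]
    exact congrArg (Multiset.cons _) (congrArg (Multiset.cons _) (Multiset.pair_comm _ _))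
  · simp only [Multiset.insert_eq_cons, Multiset.mem_cons, Multiset.mem_singleton] at hr
    rcases hr with rfl | rfl | rfl | rfl <;>
      simp only [Complex.star_def, Complex.add_re, Complex.conj_re] <;> positivity

lemma contHahn_partial_fractions {u e₀ e₁ e₂ : ℂ} (hu : u ≠ 0) (hu₁ : u + 1 ≠ 0)
    (hu₂ : u + 2 ≠ 0) :
    -((u / 2 + 1 - e₀) * (u / 2 + 1 + e₁) * (u / 2 + 1 + e₂) / ((u + 1) * (u + 2))) +
      (u / 2 + e₀) * (u / 2 - e₂) * (u / 2 - e₁) / (u * (u + 1)) =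
    -(1 - e₀ + e₁ + e₂) / 2 + 2 * (e₀ * e₁ * e₂) / (u * (u + 2)) := by
  field_simp
  ring

lemma contHahnA_add_contHahnC {u e₀ e₁ e₂ : ℂ} {n : ℕ} (hn : 1 ≤ n)
    (he₀ : e₀ = 1 - (a + b + c + d) / 2) (he₁ : e₁ = (a + c - b - d) / 2)
    (he₂ : e₂ = (a + d - b - c) / 2) (hu : u = 2 * n + (a + b + c + d) - 2) (hu₀ : u ≠ 0)
    (hu₁ : u + 1 ≠ 0) (hu₂ : u + 2 ≠ 0) :
    contHahnA a b c d n + contHahnC a b c d n =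
      -(1 - e₀ + e₁ + e₂) / 2 + 2 * (e₀ * e₁ * e₂) / (u * (u + 2)) := by
  rw [← contHahn_partial_fractions hu₀ hu₁ hu₂]
  obtain ⟨k, rfl⟩ := Nat.exists_eq_add_of_le' hn
  rw [contHahnA, contHahnC]
  generalize ((k + 1 : ℕ) : ℂ) = n at hu ⊢
  rw [show n + a + b + c + d - 1 = u / 2 + 1 - e₀ by rw [hu, he₀]; ring,
    show n + a + c = u / 2 + 1 + e₁ by rw [hu, he₁]; ring,
    show n + a + d = u / 2 + 1 + e₂ by rw [hu, he₂]; ring,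
    show n + b + c - 1 = u / 2 - e₂ by rw [hu, he₂]; ring,
    show n + b + d - 1 = u / 2 - e₁ by rw [hu, he₁]; ring,
    show 2 * n + a + b + c + d - 2 = u by rw [hu]; ring,
    show 2 * n + a + b + c + d - 1 = u + 1 by rw [hu]; ring,
    show 2 * n + a + b + c + d = u + 2 by rw [hu]; ring,
    show n = u / 2 + e₀ by rw [hu, he₀]; ring]

/-- The numbers `e` such that `α n ^ 2` is, up to a factor common to all parameters, the product
of the `(n + s / 2) ^ 2 - e ^ 2`, where `s = a + b + c + d`. -/
def contHahnShifts (a b c d : ℂ) : Multiset ℂ :=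
  {1 - (a + b + c + d) / 2, (a + c - b - d) / 2, (a + d - b - c) / 2}

lemma exists_contHahnβ_eq_diagForm {s : ℝ} (hs₀ : 0 < s) (hs : (s : ℂ) = a + b + c + d) :
    ∃ c₀ : ℝ, ∀ n ≥ 1, contHahnβ a b c d n = diagForm 0 0 c₀
      (Complex.I * (2 * (contHahnShifts a b c d).prod)).re s n := by
  set e₀ : ℂ := 1 - s / 2 with he₀
  set e₁ := (a + c - b - d) / 2 with he₁
  set e₂ := (a + d - b - c) / 2 with he₂
  refine ⟨(Complex.I * (-(1 - e₀ + e₁ + e₂) / 2 + a)).re, fun n hn => ?_⟩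
  have hn₁ : (1 : ℝ) ≤ n := Nat.one_le_cast.2 hn
  obtain ⟨u, hu⟩ : ∃ u : ℝ, u = 2 * n + s - 2 := ⟨_, rfl⟩
  have huC : (u : ℂ) = 2 * n + s - 2 := by rw [hu]; push_cast; ring
  have hsum := contHahnA_add_contHahnC (u := u) hn (hs ▸ he₀) he₁ he₂ (hs ▸ huC)
    (mod_cast (by linarith : u ≠ 0)) (mod_cast (by linarith : u + 1 ≠ 0))
    (mod_cast (by linarith : u + 2 ≠ 0))
  have hAC : Complex.I * (contHahnA a b c d n + contHahnC a b c d n + a) =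
      Complex.I * (-(1 - e₀ + e₁ + e₂) / 2 + a) +
        Complex.I * (2 * (e₀ * e₁ * e₂)) / ((u * (u + 2) : ℝ) : ℂ) := by
    rw [hsum]
    push_cast
    ring
  have hprod : (contHahnShifts a b c d).prod = e₀ * e₁ * e₂ := by
    simp only [contHahnShifts, ← hs, Multiset.insert_eq_cons, Multiset.prod_cons,
      Multiset.prod_singleton, mul_assoc, he₀, he₁, he₂]
  rw [contHahnβ, hprod, hAC, Complex.add_re, Complex.div_ofReal_re, diagForm, hu]
  ring

lemma ContHahnAdmissible.sq_mul (hadm : ContHahnAdmissible a b c d) {s : ℝ} (hs₀ : 0 < s)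
    (hs : (s : ℂ) = a + b + c + d) {n : ℕ} (hn : 1 ≤ n) {w : ℂ} (hw : w = (n + s / 2) ^ 2) :
    (contHahnα a b c d n : ℂ) ^ 2 * (w * (w - 1 / 4)) =
      (1 / 16 : ℝ) * ((contHahnShifts a b c d).map fun e => w - e ^ 2).prod := by
  rw [contHahnα, ofReal_sqrt_re_sq (hadm.mul_pos n), contHahnA_mul_contHahnC hs, mul_right_comm,
    commonWeight_mul hs₀ hn hw, contHahnShifts, ← hs]
  simp only [Multiset.insert_eq_cons, Multiset.map_cons, Multiset.map_singleton,
    Multiset.prod_cons, Multiset.prod_singleton]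
  rw [show w - ((a + c - b - d) / 2) ^ 2 = (n + (a + c)) * (n + (b + d)) by rw [hw, hs]; ring,
    show w - ((a + d - b - c) / 2) ^ 2 = (n + (a + d)) * (n + (b + c)) by rw [hw, hs]; ring]
  push_cast
  generalize a + c = p₁, a + d = p₂, b + c = p₃, b + d = p₄
  ring

lemma eq_zero_of_sq_sq_neg_sq_eq {x y z : ℝ} {E : ℂ}
    (h : ({(x : ℂ) ^ 2, (y : ℂ) ^ 2, -(z : ℂ) ^ 2} : Multiset ℂ) = {1 / 4, E, E}) : E = 0 := by
  simp only [Multiset.insert_eq_cons] at h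
  have hz : -(z : ℂ) ^ 2 ∈ ({1 / 4, E, E} : Multiset ℂ) := by
    simp only [Multiset.insert_eq_cons, ← h, Multiset.mem_cons, Multiset.mem_singleton, or_true]
  obtain rfl : -(z : ℂ) ^ 2 = E := by
    simp only [Multiset.insert_eq_cons, Multiset.mem_cons, Multiset.mem_singleton, or_self] at hz
    refine hz.resolve_left fun hz => ?_
    have hz : -z ^ 2 = 1 / 4 := Complex.ofReal_injective (by push_cast; exact hz)
    linarith [sq_nonneg z]
  have hxy : -(z : ℂ) ^ 2 ∈ ({(x : ℂ) ^ 2, (y : ℂ) ^ 2} : Multiset ℂ) := by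
    have hcancel : ({(x : ℂ) ^ 2, (y : ℂ) ^ 2} : Multiset ℂ) = {1 / 4, -(z : ℂ) ^ 2} := by
      simp only [Multiset.insert_eq_cons, ← Multiset.singleton_add, ← add_assoc] at h ⊢
      exact add_right_cancel h
    simp [hcancel]
  have hz₀ : z ^ 2 = 0 := by
    simp only [Multiset.insert_eq_cons, Multiset.mem_cons, Multiset.mem_singleton] at hxy
    rcases hxy with h | h <;> norm_cast at h <;> nlinarith [sq_nonneg x, sq_nonneg y, sq_nonneg z]
  exact_mod_cast neg_eq_zero.2 hz₀

lemma ContHahnAdmissible.contHahnShifts_eq (hadm : ContHahnAdmissible a b c d) :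
    contHahnShifts a b c d = {((1 - (a.re + b.re) : ℝ) : ℂ), ((a.re - b.re : ℝ) : ℂ),
      (a.im - b.im : ℝ) * Complex.I} := by
  obtain ⟨rfl, rfl, -, -⟩ := hadm
  have he₀ : 1 - (a + b + star a + star b) / 2 = ((1 - (a.re + b.re) : ℝ) : ℂ) :=
    Complex.ext (by simp; ring) (by simp)
  have he₁ : (a + star a - b - star b) / 2 = ((a.re - b.re : ℝ) : ℂ) :=
    Complex.ext (by simp; ring) (by simp)
  have he₂ : (a + star b - b - star a) / 2 = (a.im - b.im : ℝ) * Complex.I :=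
    Complex.ext (by simp) (by simp; ring)
  rw [contHahnShifts, he₀, he₁, he₂]

lemma HankelRows.map_sq_contHahnShifts_eq {h : ℕ → ℂ}
    (hr : HankelRows (contHahnα a b c d) (contHahnβ a b c d) h) (hh : h ≠ 0)
    (hadm : ContHahnAdmissible a b c d) :
    ((contHahnShifts a b c d).map fun e => e ^ 2) = {1 / 4, 0, 0} := by
  have hs₀ := hadm.re_add_pos
  have hs := hadm.ofReal_re_add
  obtain ⟨c₀, hβ⟩ := exists_contHahnβ_eq_diagForm hs₀ hs
  obtain ⟨N, hcard, hN⟩ := hr.exists_map_sq_eq hh (fun n => sqrt_re_pos (hadm.mul_pos n)) hs₀ hβ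
    (by norm_num) (contHahnShifts a b c d) (j := 1) rfl one_le_two (fun _ => le_rfl)
    fun n hn w hw => hadm.sq_mul hs₀ hs hn hw
  obtain ⟨E, rfl⟩ : ∃ E, N = {E} := Multiset.card_eq_one.1 hcard
  replace hN : ((contHahnShifts a b c d).map fun e => e ^ 2) = {1 / 4, E, E} := hN
  suffices hE : E = 0 by rw [hN, hE]
  rw [hadm.contHahnShifts_eq] at hN
  simp only [Multiset.insert_eq_cons, Multiset.map_cons, Multiset.map_singleton, mul_pow,
    Complex.I_sq, mul_neg_one] at hN
  exact eq_zero_of_sq_sq_neg_sq_eq hN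

theorem eq_zero_of_contHahn {h : ℕ → ℂ} (hlim : Tendsto h atTop (𝓝 0))
    (hadm : ContHahnAdmissible a b c d)
    (hr : HankelRows (contHahnα a b c d) (contHahnβ a b c d) h) : h = 0 := by
  by_contra hh
  have hs₀ := hadm.re_add_pos
  have hs := hadm.ofReal_re_add
  obtain ⟨c₀, hβ⟩ := exists_contHahnβ_eq_diagForm hs₀ hs
  have hshifts := hr.map_sq_contHahnShifts_eq hh hadm
  generalize (a + b + c + d).re = s at hs₀ hs hβ
  have hα (n : ℕ) : 0 < contHahnα a b c d n := sqrt_re_pos (hadm.mul_pos n)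
  have hprod : (contHahnShifts a b c d).prod = 0 := by
    have hsq := congrArg Multiset.prod hshifts
    rw [Multiset.prod_map_pow, Multiset.map_id'] at hsq
    simpa using hsq
  refine hh <| hr.eq_zero_of_affine_of_const (γ := 1 / 4) (p := s / 2) (c₀ := c₀)
    (fun n => (hα n).ne') hlim (fun n hn => ?_) fun n hn => ?_
  · have hsq : (contHahnα a b c d n : ℂ) ^ 2 = ((1 / 4 * (n + s / 2) : ℝ) : ℂ) ^ 2 := by
      apply mul_right_cancel₀ (mul_sub_one_quarter_ne_zero hs₀ hn)
      rw [hadm.sq_mul hs₀ hs hn rfl, prod_map_sub_sq, hshifts]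
      simp only [Multiset.insert_eq_cons, Multiset.map_cons, Multiset.map_singleton,
        Multiset.prod_cons, Multiset.prod_singleton]
      push_cast
      ring
    exact (sq_eq_sq₀ (hα n).le (by positivity)).1 (mod_cast hsq)
  · rw [hβ n hn, hprod, mul_zero, mul_zero, Complex.zero_re, diagForm, zero_div]
    ring

end ContHahn

section TransformedHilbert

variable {t : ℝ}

lemma signConj_signConj (H : Matrix ℕ ℕ ℂ) : signConj (signConj H) = H := by
  have hsign (k : ℕ) : (-1 : ℂ) ^ k * (-1) ^ k = 1 := by rw [← mul_pow]; norm_num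
  ext m n
  simp only [signConj, Matrix.of_apply]
  linear_combination H m n * ((-1) ^ n * (-1) ^ n * hsign m + hsign n)

lemma signConj_smul_hilbertMatrix (κ : ℂ) (t : ℝ) :
    signConj (κ • hilbertMatrix t) = κ • transformedHilbert t := by
  ext m n
  simp only [signConj, hilbertMatrix, transformedHilbert, Matrix.smul_apply, Matrix.of_apply,
    smul_eq_mul, pow_add]
  ring

lemma signConj_eq_smul_hilbertMatrix_iff {H : Matrix ℕ ℕ ℂ} {κ : ℂ} :
    signConj H = κ • hilbertMatrix t ↔ H = κ • transformedHilbert t := by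
  rw [Function.Involutive.eq_iff (f := signConj) signConj_signConj, signConj_smul_hilbertMatrix,
    eq_comm]

lemma isHankel_hankelMatrix (h : ℕ → ℂ) : IsHankel (hankelMatrix h) := ⟨h, fun _ _ => rfl⟩

lemma hankelMatrix_smul (κ : ℂ) (h : ℕ → ℂ) : hankelMatrix (κ • h) = κ • hankelMatrix h := rfl

lemma isHankel_smul_transformedHilbert (t : ℝ) (κ : ℂ) : IsHankel (κ • transformedHilbert t) := by
  rw [← hankelMatrix_alternatingHilbert, ← hankelMatrix_smul]
  exact isHankel_hankelMatrix _

lemma hasL2Columns_smul_transformedHilbert (t : ℝ) (κ : ℂ) :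
    HasL2Columns (κ • transformedHilbert t) := by
  intro n
  have hsum : Summable fun m : ℕ => ‖κ‖ ^ 2 * (1 / |(m : ℝ) + (n + t)| ^ (2 : ℝ)) :=
    ((Real.summable_one_div_nat_add_rpow (n + t) 2).2 one_lt_two).mul_left _
  refine hsum.congr fun m => ?_
  have hnorm : ‖(m : ℂ) + n + t‖ = |(m : ℝ) + (n + t)| := by
    rw [← Real.norm_eq_abs, ← Complex.norm_real]
    push_cast
    rw [add_assoc]
  rw [Matrix.smul_apply, transformedHilbert, Matrix.of_apply, smul_eq_mul, norm_mul, norm_div,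
    norm_pow, norm_neg, norm_one, one_pow, hnorm, Real.rpow_two, mul_pow, div_pow, one_pow]

lemma linearIndependent_col_transformedHilbert (ht : 0 < t) :
    LinearIndependent ℂ (transformedHilbert t).col := by
  rw [linearIndependent_iff']
  intro s g hg
  have hzero := eq_zero_of_sum_div_natCast_add_eq_zero (s := s) (c := fun j => g j * (-1) ^ j)
    (z := fun j => j + t) (fun i _ j _ hij => Nat.cast_injective (add_right_cancel hij)) 0
    (fun m _ j _ => ?_) fun m _ => ?_
  · exact fun i hi => (mul_eq_zero.1 (hzero i hi)).resolve_right
      (pow_ne_zero i (neg_ne_zero.2 one_ne_zero))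
  · simpa [add_assoc] using natCast_add_ofReal_ne_zero ht (m + j)
  · have hrow := congrFun hg m
    simp only [Finset.sum_apply, Pi.smul_apply, Matrix.col_apply, transformedHilbert,
      Matrix.of_apply, smul_eq_mul, Pi.zero_apply] at hrow
    refine (mul_eq_zero.1 ?_).resolve_left (pow_ne_zero m (neg_ne_zero.2 one_ne_zero))
    rw [← hrow, Finset.mul_sum]
    refine Finset.sum_congr rfl fun j _ => ?_
    rw [pow_add, add_assoc]
    ring

lemma eRank_smul_transformedHilbert (ht : 0 < t) {κ : ℂ} (hκ : κ ≠ 0) :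
    (κ • transformedHilbert t).eRank = ⊤ := by
  have hindep : LinearIndependent ℂ (κ • transformedHilbert t).col :=
    (linearIndependent_col_transformedHilbert ht).units_smul fun _ => Units.mk0 κ hκ
  rw [Matrix.eRank, Cardinal.toENat_eq_top, Matrix.cRank, rank_span hindep,
    Cardinal.mk_range_eq _ hindep.injective]
  exact Cardinal.aleph0_le_mk ℕ

lemma alternatingHilbert_recurrence (ht : 0 < t) (k : ℕ) :
    (k + t) * alternatingHilbert t k + 2 * (k + 1 + t) * alternatingHilbert t (k + 1) +
      (k + 2 + t) * alternatingHilbert t (k + 2) = 0 := by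
  have hk₀ := natCast_add_ofReal_ne_zero ht k
  have hk₁ := natCast_add_ofReal_ne_zero ht (k + 1)
  have hk₂ := natCast_add_ofReal_ne_zero ht (k + 2)
  simp only [alternatingHilbert]
  push_cast at hk₁ hk₂ ⊢
  field_simp
  ring

lemma hankelRows_of_recurrence {α β : ℕ → ℝ} {h : ℕ → ℂ} {c₀ : ℝ}
    (hα : ∀ n, α n = (n + 1) * (n + t)) (hβ : ∀ n, β n = 2 * n ^ 2 + 2 * t * n + c₀)
    (hrec : ∀ k : ℕ, (k + t) * h k + 2 * (k + 1 + t) * h (k + 1) + (k + 2 + t) * h (k + 2) = 0) :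
    HankelRows α β h where
  row_zero n := by
    simp only [rowForm, window, hα, hβ]
    push_cast
    linear_combination ((n : ℂ) + 1) * hrec n
  row_succ m n := by
    simp only [rowForm, window, hα, hβ]
    have := hrec (m + n + 1)
    push_cast at this ⊢
    linear_combination ((n : ℂ) - m) * this

lemma contDualHahnAdmissible_half_half (ht : 0 < t) :
    ContDualHahnAdmissible (1 / 2) (1 / 2) ((t - 1 / 2 : ℝ) : ℂ) := by
  have hhalf : (1 / 2 : ℂ) = ((1 / 2 : ℝ) : ℂ) := by push_cast; rfl
  rw [hhalf]
  refine ⟨?_, ?_⟩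
  · simp only [ConjPaired, Multiset.insert_eq_cons, Multiset.map_cons, Multiset.map_singleton,
      Complex.star_def, Complex.conj_ofReal]
  · rcases lt_or_ge (1 / 2) t with h | h
    · left
      simp only [Complex.ofReal_re]
      exact ⟨by norm_num, by norm_num, by linarith⟩
    · refine .inr ⟨((t - 1 / 2 : ℝ) : ℂ), ((1 / 2 : ℝ) : ℂ), ((1 / 2 : ℝ) : ℂ), ?_,
        Complex.ofReal_im _, ?_⟩
      · simp only [Multiset.insert_eq_cons, ← Multiset.singleton_add]
        abel
      · simp only [Complex.add_re, Complex.ofReal_re]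
        exact ⟨by linarith, by linarith, by linarith⟩

lemma contDualHahnα_half_half (ht : 0 < t) (n : ℕ) :
    contDualHahnα (1 / 2) (1 / 2) ((t - 1 / 2 : ℝ) : ℂ) n = (n + 1) * (n + t) := by
  have hsq : contDualHahnA (1 / 2) (1 / 2) ((t - 1 / 2 : ℝ) : ℂ) n *
      contDualHahnC (1 / 2) (1 / 2) ((t - 1 / 2 : ℝ) : ℂ) (n + 1) =
      ((((n + 1) * (n + t)) ^ 2 : ℝ) : ℂ) := by
    rw [contDualHahnA, contDualHahnC]
    push_cast
    ring
  rw [contDualHahnα, hsq, Complex.ofReal_re, Real.sqrt_sq (by positivity)]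

lemma contDualHahnβ_half_half (t : ℝ) (n : ℕ) :
    contDualHahnβ (1 / 2) (1 / 2) ((t - 1 / 2 : ℝ) : ℂ) n =
      2 * n ^ 2 + 2 * t * n + (t - 1 / 4) := by
  have hreal : contDualHahnA (1 / 2) (1 / 2) ((t - 1 / 2 : ℝ) : ℂ) n +
      contDualHahnC (1 / 2) (1 / 2) ((t - 1 / 2 : ℝ) : ℂ) n - (1 / 2) ^ 2 =
      ((2 * n ^ 2 + 2 * t * n + (t - 1 / 4) : ℝ) : ℂ) := by
    rw [contDualHahnA, contDualHahnC]
    push_cast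
    ring
  rw [contDualHahnβ, hreal, Complex.ofReal_re]

theorem exists_isAskeyJacobi_mul_comm_transformedHilbert (ht : 0 < t) (κ : ℂ) :
    ∃ J, IsAskeyJacobi J ∧
      mul (κ • transformedHilbert t) J = mul J (κ • transformedHilbert t) := by
  refine ⟨_, .contDualHahn _ _ _ (contDualHahnAdmissible_half_half ht), ?_⟩
  rw [← hankelMatrix_alternatingHilbert, ← hankelMatrix_smul, mul_comm_iff_hankelRows]
  refine hankelRows_of_recurrence (contDualHahnα_half_half ht) (contDualHahnβ_half_half t)
    fun k => ?_
  simp only [Pi.smul_apply, smul_eq_mul]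
  linear_combination κ * alternatingHilbert_recurrence ht k

end TransformedHilbert

section Classification

theorem exists_eq_smul_transformedHilbert_of_mul_comm {H J : Matrix ℕ ℕ ℂ} (hH : IsHankel H)
    (hL : HasL2Columns H) (hrank : 1 < H.eRank) (hJ : IsAskeyJacobi J) (hc : mul H J = mul J H) :
    ∃ t : ℝ, 0 < t ∧ ∃ κ : ℂ, H = κ • transformedHilbert t := by
  obtain ⟨h, rfl⟩ := hH.exists_eq_hankelMatrix
  have hlim : Tendsto h atTop (𝓝 0) := hL.tendsto_zero
  have hgeom : ¬IsGeometric h := fun hg => hrank.not_ge hg.eRank_hankelMatrix_le_one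
  have hne : h ≠ 0 := fun hz => hgeom (hz ▸ IsGeometric.zero)
  suffices ∃ t : ℝ, 0 < t ∧ ∃ κ : ℂ, h = κ • alternatingHilbert t by
    obtain ⟨t, ht, κ, rfl⟩ := this
    exact ⟨t, ht, κ, by rw [hankelMatrix_smul, hankelMatrix_alternatingHilbert]⟩
  cases hJ <;> rw [mul_comm_iff_hankelRows] at hc
  case wilson hadm =>
    exact exists_eq_smul_alternatingHilbert_of_wilson hlim hne hadm hc
  case contDualHahn hadm =>
    exact exists_eq_smul_alternatingHilbert_of_contDualHahn hlim hne hadm hc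
  case contHahn hadm => exact absurd (eq_zero_of_contHahn hlim hadm hc) hne
  case jacobi hp hq => exact absurd (isGeometric_of_jacobi hp hq hc) hgeom
  case meixnerPollaczek hl hφ₀ hφπ =>
    exact absurd (isGeometric_of_meixnerPollaczek hlim hl hφ₀ hφπ hc) hgeom
  case meixner hc₀ hc₁ hb => exact absurd (isGeometric_of_meixner hlim hc₀ hc₁ hb hc) hgeom
  case laguerre hp => exact absurd (isGeometric_of_laguerre hlim hp hc) hgeom
  case charlier ha => exact absurd (eq_zero_of_charlier ha hc) hne
  case hermite => exact absurd (eq_zero_of_hermite hc) hne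

end Classification

end AskeyHankel

end

theorem mainTheorem2 :
    (∀ H J : Matrix ℕ ℕ ℂ,
      AskeyHankel.IsHankel H → AskeyHankel.HasL2Columns H → 1 < H.eRank →
      AskeyHankel.IsAskeyJacobi J → AskeyHankel.mul H J = AskeyHankel.mul J H →
      ∃ t : ℝ, 0 < t ∧ ∃ κ : ℂ, H = κ • AskeyHankel.transformedHilbert t) ∧
    (∀ H : Matrix ℕ ℕ ℂ,
      (AskeyHankel.IsHankel H ∧ AskeyHankel.HasL2Columns H ∧ H.eRank = ⊤ ∧
        ∃ J, AskeyHankel.IsAskeyJacobi J ∧ AskeyHankel.mul H J = AskeyHankel.mul J H) ↔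
      ∃ t : ℝ, 0 < t ∧ ∃ κ : ℂ, κ ≠ 0 ∧
        AskeyHankel.signConj H = κ • AskeyHankel.hilbertMatrix t) := by
  open AskeyHankel in
  refine ⟨fun H J hH hL hrank hJ hc =>
    exists_eq_smul_transformedHilbert_of_mul_comm hH hL hrank hJ hc, fun H => ⟨?_, ?_⟩⟩
  · rintro ⟨hH, hL, hrank, J, hJ, hc⟩
    obtain ⟨t, ht, κ, rfl⟩ := exists_eq_smul_transformedHilbert_of_mul_comm hH hL
      (hrank ▸ ENat.natCast_lt_top 1) hJ hc
    refine ⟨t, ht, κ, ?_, signConj_eq_smul_hilbertMatrix_iff.2 rfl⟩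
    rintro rfl
    simp at hrank
  · rintro ⟨t, ht, κ, hκ, hsign⟩
    obtain rfl := signConj_eq_smul_hilbertMatrix_iff.1 hsign
    exact ⟨isHankel_smul_transformedHilbert t κ, hasL2Columns_smul_transformedHilbert t κ,
      eRank_smul_transformedHilbert ht hκ, exists_isAskeyJacobi_mul_comm_transformedHilbert ht κ⟩
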